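/- All algebras are unital over $\mathbb C$; repeated indices are summed. Let $\mathcal A=\mathrm{Poly}(H)$ be a Hopf algebra with comultiplication $\Delta$, counit $\epsilon$ and bijective antipode. A representation of $H$ is a matrix $v\in M_N(\mathcal A)$ with $\Delta v_{ij}=v_{ik}\otimes v_{kj}$ and $\epsilon(v_{ij})=\delta_{ij}$; $\mathrm{Mor}(v,w)$ is the set of complex matrices $M$ with $Mv=wM$; for matrices $v,w$ over an algebra, $(v\otimes w)_{ij,kl}=v_{ik}w_{jl}$; for $\rho\in\mathcal A'$ and $a\in\mathcal A$ put $a*\rho=(\rho\otimes\mathrm{id})\Delta a$ and $\rho*a=(\mathrm{id}\otimes\rho)\Delta a$. Let $\mathcal I$ be a finite set and $\Lambda=(\Lambda_{ij})_{i,j\in\mathcal I}$ a representation of $H$. Assume that every representation of $H$ is completely reducible, that $\Lambda$ is irreducible, and that $\mathrm{Mor}(v\otimes w,\Lambda\otimes v\otimes w)=\{0\}$ for all irreducible representations $v,w$ of $H$. Let $\mathcal B$ be a bialgebra containing $\mathcal A$ as a sub-bialgebra and let $p_i\in\mathcal B$ $(i\in\mathcal I)$ be such that: $\mathcal B$ is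 generated as an algebra by $\mathcal A$ and the $p_i$; the matrix $\mathcal P=\begin{pmatrix}\Lambda&p\\0&I\end{pmatrix}$ satisfies $\Delta\mathcal P_{ij}=\mathcal P_{ik}\otimes\mathcal P_{kj}$, $\epsilon(\mathcal P_{ij})=\delta_{ij}$; some $p_i\notin\mathcal A$; and $\Gamma\mathcal A\subset\Gamma$, where $\Gamma=\mathcal A\cdot\mathrm{span}\{p_i\}+\mathcal A$. Then there are unique functionals $f_{st}\in\mathcal A'$ with $p_sa-(a*f_{st})p_t\in\mathcal A$ for all $s\in\mathcal I$, $a\in\mathcal A$. Put $R_{ij,sm}=f_{im}(\Lambda_{js})$, and let $\mathbf 1$ denote unit matrices. Assume that $R^2=\mathbf 1$ and that, for every $x\in\mathbb C^{\mathcal I\times\mathcal I}$, $$x(R+\mathbf 1)=0\iff x_{ij}p_ip_j\in\Gamma$$ (that is, $\mathcal B$ has as many relations $x_{ij}p_ip_j+b_ip_i+c=0$ with $b_i,c\in\mathcal A$ as possible). Then there are functionals $\eta_s\in\mathcal A'$ and numbers $T_{ij}\in\mathbb C$ such that $\Lambda_{st}(f_{tr}*a)=(a*f_{st})\Lambda_{tr}$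 for all $a\in\mathcal A$, the map $a\mapsto\begin{pmatrix}f(a)&\eta(a)\\0&\epsilon(a)\end{pmatrix}$ is a unital homomorphism, and the relations (1) and (2) below hold in $\mathcal B$. Moreover, for any $\eta$ and $T$ for which (1) and (2) hold in $\mathcal B$: a) $\mathcal B$ is the universal unital algebra generated by $\mathcal A$ and $p_i$ $(i\in\mathcal I)$ with the relations $I_{\mathcal B}=I_{\mathcal A}$, $$p_sa=(a*f_{st})p_t+a*\eta_s-\Lambda_{st}(\eta_t*a),\qquad s\in\mathcal I,\ a\in\mathcal A,\tag{1}$$ $$(R-\mathbf 1)_{kl,ij}\bigl(p_ip_j-\eta_i(\Lambda_{js})p_s+T_{ij}-\Lambda_{im}\Lambda_{jn}T_{mn}\bigr)=0,\qquad k,l\in\mathcal I.\tag{2}$$ b) $\mathcal B$ is the universal unital algebra generated by $\mathcal A$ and $p_i$ $(i\in\mathcal I)$ with the relations $I_{\mathcal B}=I_{\mathcal A}$, $$(\mathcal P\otimes w)N_w=N_w(w\otimes\mathcal P)\quad\text{for every representation } w \text{ of } H,$$ $$R_P(\mathcal P\otimes\mathcal P)=(\mathcal P\otimes\mathcal P)R_P,$$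 where $$R_P=\begin{pmatrix}R&Z&-RZ&(R-\mathbf 1)T\\0&0&\mathbf 1&0\\0&\mathbf 1&0&0\\0&0&0&1\end{pmatrix},\qquad N_w=\begin{pmatrix}G_w&H_w\\0&\mathbf 1\end{pmatrix},$$ $(G_w)_{iC,Dj}=f_{ij}(w_{CD})$, $(H_w)_{iC,D}=\eta_i(w_{CD})$, $R=G_\Lambda$, $Z=H_\Lambda$; the blocks of $R_P$ correspond to the decomposition of $(\mathbb C^{\mathcal I}\oplus\mathbb C)^{\otimes2}$ into $\mathbb C^{\mathcal I}\otimes\mathbb C^{\mathcal I}$, $\mathbb C^{\mathcal I}\otimes\mathbb C$, $\mathbb C\otimes\mathbb C^{\mathcal I}$, $\mathbb C\otimes\mathbb C$, in this order. -/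

import Mathlib

universe w u v x

open scoped TensorProduct Kronecker

namespace InhomQG

noncomputable section

/-! ### Representations (finite-dimensional matrix corepresentations) of a bialgebra over `ℂ` -/

section Rep

variable {A : Type*} [Ring A] [Bialgebra ℂ A]

/-- `v` is a representation: `Δ v_ij = ∑ₖ v_ik ⊗ v_kj` and `ε(v_ij) = δ_ij`. -/
def IsRep {n : Type*} [Fintype n] [DecidableEq n] (v : Matrix n n A) : Prop :=
  (∀ i j, Coalgebra.comul (R := ℂ) (v i j) = ∑ k, v i k ⊗ₜ[ℂ] v k j) ∧
    ∀ i j, Coalgebra.counit (R := ℂ) (v i j) = (1 : Matrix n n ℂ) i j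

/-- The subspace `W ⊆ ℂⁿ` is invariant under `v`, i.e. `v W ⊆ W ⊗ A`; tested by applying the
linear functionals on `A` to the entries of `v`. -/
def IsInvariant {n : Type*} [Fintype n] (v : Matrix n n A) (W : Submodule ℂ (n → ℂ)) : Prop :=
  ∀ φ : A →ₗ[ℂ] ℂ, ∀ x ∈ W, (v.map φ).mulVec x ∈ W

/-- Irreducible representation: nonzero, without nontrivial invariant subspaces. -/
def IsIrrep {n : Type*} [Fintype n] [DecidableEq n] (v : Matrix n n A) : Prop :=
  IsRep v ∧ Nonempty n ∧
    ∀ W : Submodule ℂ (n → ℂ), IsInvariant v W → W = ⊥ ∨ W = ⊤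

/-- Complete reducibility: each invariant subspace has an invariant complement. -/
def IsCompletelyReducible {n : Type*} [Fintype n] (v : Matrix n n A) : Prop :=
  ∀ W : Submodule ℂ (n → ℂ), IsInvariant v W →
    ∃ W' : Submodule ℂ (n → ℂ), IsInvariant v W' ∧ IsCompl W W'

/-- A complex matrix, seen as a matrix over a `ℂ`-algebra. -/
def scal (C : Type*) [Ring C] [Algebra ℂ C] {m n : Type*} (M : Matrix m n ℂ) : Matrix m n C :=
  M.map (algebraMap ℂ C)

/-- `M ∈ Mor(v, w)`, i.e. `M v = w M`. -/
def IsMor {m n : Type*} [Fintype m] [Fintype n] (v : Matrix m m A) (w : Matrix n n A)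
    (M : Matrix n m ℂ) : Prop :=
  scal A M * v = w * scal A M

/-- `a * ρ = (ρ ⊗ id) Δ a`. -/
def actR (ρ : A →ₗ[ℂ] ℂ) : A →ₗ[ℂ] A :=
  (TensorProduct.lid ℂ A).toLinearMap ∘ₗ LinearMap.rTensor A ρ ∘ₗ Coalgebra.comul

/-- `ρ * a = (id ⊗ ρ) Δ a`. -/
def actL (ρ : A →ₗ[ℂ] ℂ) : A →ₗ[ℂ] A :=
  (TensorProduct.rid ℂ A).toLinearMap ∘ₗ LinearMap.lTensor A ρ ∘ₗ Coalgebra.comul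

end Rep

/-! ### The homogeneous part -/

/-- The assumptions on the quantum group `H` with `Poly(H) = A` and on `Λ`: the coinverse of `A`
is invertible, each representation is completely reducible, `Λ` is irreducible, and
`Mor(v ⊗ w, Λ ⊗ v ⊗ w) = 0` for irreducible `v`, `w`. -/
structure HomogeneousData {A I : Type*} [Ring A] [HopfAlgebra ℂ A] [Fintype I] [DecidableEq I]
    (Λ : Matrix I I A) : Prop where
  antipode_bijective : Function.Bijective (HopfAlgebra.antipode ℂ : A →ₗ[ℂ] A)
  completelyReducible : ∀ (n : ℕ) (v : Matrix (Fin n) (Fin n) A), IsRep v →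
    IsCompletelyReducible v
  irreducible : IsIrrep Λ
  mor_eq_zero : ∀ (m n : ℕ) (v : Matrix (Fin m) (Fin m) A) (w : Matrix (Fin n) (Fin n) A),
    IsIrrep v → IsIrrep w → ∀ M : Matrix (I × (Fin m × Fin n)) (Fin m × Fin n) ℂ,
      IsMor (v ⊗ₖ w) (Λ ⊗ₖ (v ⊗ₖ w)) M → M = 0

/-! ### Inhomogeneous quantum groups -/

section Inhom

variable {A C I : Type*} [Ring A] [Ring C]

/-- The matrix `𝒫 = [[Λ, q], [0, 1]]` over `C`, where `Λ` is transported along `φ : A → C`. -/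
def Pmat [Bialgebra ℂ A] [Algebra ℂ C] (φ : A →ₐ[ℂ] C) (Λ : Matrix I I A) (q : I → C) :
    Matrix (I ⊕ Unit) (I ⊕ Unit) C :=
  Matrix.fromBlocks (Λ.map φ) (Matrix.of fun i _ => q i) 0 1

/-- `Γ = A · span{p_i} + A` inside `C`. -/
def Gam [Bialgebra ℂ A] [Algebra ℂ C] (φ : A →ₐ[ℂ] C) (p : I → C) : Submodule ℂ C :=
  Submodule.span ℂ (Set.range fun x : A × I => φ x.1 * p x.2) ⊔ LinearMap.range φ.toLinearMap

/-- The bialgebra `B` with the embedding `ι : A → B` and the elements `p_i` is an inhomogeneous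
quantum group built from `A` and `Λ`. -/
structure IsInhomogeneous {B : Type*} [Ring B] [Bialgebra ℂ A] [Bialgebra ℂ B]
    [Fintype I] [DecidableEq I] (Λ : Matrix I I A) (ι : A →ₐc[ℂ] B) (p : I → B) : Prop where
  generates : Algebra.adjoin ℂ (Set.range ι ∪ Set.range p) = ⊤
  injective : Function.Injective ι
  isRep : IsRep (Pmat (ι : A →ₐ[ℂ] B) Λ p)
  notMem : ∃ i, p i ∉ Set.range ι
  mul_mem : ∀ γ ∈ Gam (ι : A →ₐ[ℂ] B) p, ∀ a : A, γ * ι a ∈ Gam (ι : A →ₐ[ℂ] B) p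

end Inhom

/-! ### Matrices built from the functionals `f`, `η` and the numbers `T` -/

section Matrices

variable {A I n : Type*} [Ring A] [Bialgebra ℂ A]

/-- `(G_w)_{iC,Dj} = f_ij(w_CD)`. -/
def Gmat (f : I → I → A →ₗ[ℂ] ℂ) (w : Matrix n n A) : Matrix (I × n) (n × I) ℂ :=
  Matrix.of fun x y => f x.1 y.2 (w x.2 y.1)

/-- `(H_w)_{iC,D} = η_i(w_CD)`. -/
def Hmat (η : I → A →ₗ[ℂ] ℂ) (w : Matrix n n A) : Matrix (I × n) n ℂ :=
  Matrix.of fun x d => η x.1 (w x.2 d)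

/-- `N_w = [[G_w, H_w], [0, 1_w]]`, with rows indexed as in `𝒫 ⊗ w` and columns as in `w ⊗ 𝒫`. -/
def Nmat [DecidableEq n] (f : I → I → A →ₗ[ℂ] ℂ) (η : I → A →ₗ[ℂ] ℂ) (w : Matrix n n A) :
    Matrix ((I ⊕ Unit) × n) (n × (I ⊕ Unit)) ℂ :=
  Matrix.of fun x y => match x, y with
    | (Sum.inl i, c), (d, Sum.inl j) => Gmat f w (i, c) (d, j)
    | (Sum.inl i, c), (d, Sum.inr _) => Hmat η w (i, c) d
    | (Sum.inr _, _), (_, Sum.inl _) => 0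
    | (Sum.inr _, c), (d, Sum.inr _) => (1 : Matrix n n ℂ) c d

/-- `R = G_Λ`, i.e. `R_{ij,sm} = f_im(Λ_js)`. -/
def Rmat (f : I → I → A →ₗ[ℂ] ℂ) (Λ : Matrix I I A) : Matrix (I × I) (I × I) ℂ := Gmat f Λ

/-- `Z = H_Λ`, i.e. `Z_{ij,s} = η_i(Λ_js)`. -/
def Zmat (η : I → A →ₗ[ℂ] ℂ) (Λ : Matrix I I A) : Matrix (I × I) I ℂ := Hmat η Λ

variable [Fintype I] [DecidableEq I]

/-- The matrix `R_P`; the four blocks correspond to the index sets `I × I`, `I × {∗}`,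
`{∗} × I`, `{∗} × {∗}`, in this order:
```
  R   Z  -RZ  (R - 1)T
  0   0   1      0
  0   1   0      0
  0   0   0      1
```
-/
def RPmat (R : Matrix (I × I) (I × I) ℂ) (Z : Matrix (I × I) I ℂ) (T : I × I → ℂ) :
    Matrix ((I ⊕ Unit) × (I ⊕ Unit)) ((I ⊕ Unit) × (I ⊕ Unit)) ℂ :=
  Matrix.of fun x y => match x, y with
    | (Sum.inl k, Sum.inl l), (Sum.inl i, Sum.inl j) => R (k, l) (i, j)
    | (Sum.inl k, Sum.inl l), (Sum.inl i, Sum.inr _) => Z (k, l) i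
    | (Sum.inl k, Sum.inl l), (Sum.inr _, Sum.inl i) => -((R * Z) (k, l) i)
    | (Sum.inl k, Sum.inl l), (Sum.inr _, Sum.inr _) => (R - 1).mulVec T (k, l)
    | (Sum.inl k, Sum.inr _), (Sum.inr _, Sum.inl i) => (1 : Matrix I I ℂ) k i
    | (Sum.inr _, Sum.inl k), (Sum.inl i, Sum.inr _) => (1 : Matrix I I ℂ) k i
    | (Sum.inr _, Sum.inr _), (Sum.inr _, Sum.inr _) => 1
    | _, _ => 0

end Matrices

/-! ### Relations, formulated in an arbitrary algebra `C` under `A` with elements `q_i` -/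

section Relations

variable {A C I : Type*} [Ring A] [Bialgebra ℂ A] [Ring C] [Algebra ℂ C]
  [Fintype I] [DecidableEq I]

/-- `q_s a - ∑ₜ (a * f_st) q_t ∈ A` for all `a ∈ A`. In an inhomogeneous quantum group this
determines `f`. -/
def IsLeading (φ : A →ₐ[ℂ] C) (q : I → C) (f : I → I → A →ₗ[ℂ] ℂ) : Prop :=
  ∀ s a, q s * φ a - ∑ t, φ (actR (f s t) a) * q t ∈ Set.range φ

/-- `q_s a = (a * f_st) q_t + a * η_s - Λ_st (η_t * a)`, for all `a ∈ A`. -/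
def CrossRel (φ : A →ₐ[ℂ] C) (q : I → C) (Λ : Matrix I I A) (f : I → I → A →ₗ[ℂ] ℂ)
    (η : I → A →ₗ[ℂ] ℂ) : Prop :=
  ∀ s a, q s * φ a =
    ∑ t, φ (actR (f s t) a) * q t + φ (actR (η s) a) - ∑ t, φ (Λ s t * actL (η t) a)

/-- `(R - 1)_{kl,ij} (q_i q_j - η_i(Λ_js) q_s + T_ij - Λ_im Λ_jn T_mn) = 0`. -/
def QuadRel (φ : A →ₐ[ℂ] C) (q : I → C) (Λ : Matrix I I A) (f : I → I → A →ₗ[ℂ] ℂ)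
    (η : I → A →ₗ[ℂ] ℂ) (T : I × I → ℂ) : Prop :=
  ∀ k l, ∑ i, ∑ j, (Rmat f Λ - 1) (k, l) (i, j) •
    (q i * q j - ∑ s, η i (Λ j s) • q s + algebraMap ℂ C (T (i, j))
      - ∑ m, ∑ n, T (m, n) • φ (Λ i m * Λ j n)) = 0

/-- `(𝒫 ⊗ w) N_w = N_w (w ⊗ 𝒫)` for all representations `w` of `H`. -/
def PNRel (φ : A →ₐ[ℂ] C) (q : I → C) (Λ : Matrix I I A) (f : I → I → A →ₗ[ℂ] ℂ)
    (η : I → A →ₗ[ℂ] ℂ) : Prop :=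
  ∀ (n : ℕ) (w : Matrix (Fin n) (Fin n) A), IsRep w →
    (Pmat φ Λ q ⊗ₖ w.map φ) * scal C (Nmat f η w)
      = scal C (Nmat f η w) * (w.map φ ⊗ₖ Pmat φ Λ q)

/-- `R_P (𝒫 ⊗ 𝒫) = (𝒫 ⊗ 𝒫) R_P`. -/
def RPRel (φ : A →ₐ[ℂ] C) (q : I → C) (Λ : Matrix I I A) (f : I → I → A →ₗ[ℂ] ℂ)
    (η : I → A →ₗ[ℂ] ℂ) (T : I × I → ℂ) : Prop :=
  scal C (RPmat (Rmat f Λ) (Zmat η Λ) T) * (Pmat φ Λ q ⊗ₖ Pmat φ Λ q)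
    = (Pmat φ Λ q ⊗ₖ Pmat φ Λ q) * scal C (RPmat (Rmat f Λ) (Zmat η Λ) T)

end Relations

/-! ### Universal algebras with given relations -/

section Universal

/-- `B`, with `ι : A → B` and `p_i ∈ B`, is the universal unital algebra generated by `A` and the
`p_i` (with the units identified) subject to `CrossRel` and `QuadRel`. -/
def IsUniversalCrossQuad {A : Type u} {B : Type v} {I : Type x} [Ring A]
    [Bialgebra ℂ A] [Ring B] [Algebra ℂ B] [Fintype I] [DecidableEq I]
    (ι : A →ₐ[ℂ] B) (p : I → B) (Λ : Matrix I I A)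
    (f : I → I → A →ₗ[ℂ] ℂ) (η : I → A →ₗ[ℂ] ℂ) (T : I × I → ℂ) : Prop :=
  (CrossRel ι p Λ f η ∧ QuadRel ι p Λ f η T) ∧
    ∀ (C : Type w) [Ring C] [Algebra ℂ C] (φ : A →ₐ[ℂ] C) (q : I → C),
      CrossRel φ q Λ f η → QuadRel φ q Λ f η T →
        ∃! ψ : B →ₐ[ℂ] C, (∀ a, ψ (ι a) = φ a) ∧ ∀ i, ψ (p i) = q i

/-- The same for the relations `PNRel` and `RPRel`. -/
def IsUniversalRMatrix {A : Type u} {B : Type v} {I : Type x} [Ring A]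
    [Bialgebra ℂ A] [Ring B] [Algebra ℂ B] [Fintype I] [DecidableEq I]
    (ι : A →ₐ[ℂ] B) (p : I → B) (Λ : Matrix I I A)
    (f : I → I → A →ₗ[ℂ] ℂ) (η : I → A →ₗ[ℂ] ℂ) (T : I × I → ℂ) : Prop :=
  (PNRel ι p Λ f η ∧ RPRel ι p Λ f η T) ∧
    ∀ (C : Type w) [Ring C] [Algebra ℂ C] (φ : A →ₐ[ℂ] C) (q : I → C),
      PNRel φ q Λ f η → RPRel φ q Λ f η T →
        ∃! ψ : B →ₐ[ℂ] C, (∀ a, ψ (ι a) = φ a) ∧ ∀ i, ψ (p i) = q i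

end Universal

/-- `Λ_st (f_tr * a) = (a * f_st) Λ_tr` for all `a ∈ A`, and
`a ↦ [[f(a), η(a)], [0, ε(a)]]` is a unital homomorphism. -/
def IsStructureData {A I : Type*} [Ring A] [Bialgebra ℂ A] [Fintype I] [DecidableEq I]
    (Λ : Matrix I I A) (f : I → I → A →ₗ[ℂ] ℂ) (η : I → A →ₗ[ℂ] ℂ) : Prop :=
  (∀ s r a, ∑ t, Λ s t * actL (f t r) a = ∑ t, actR (f s t) a * Λ t r) ∧
    ∃ ρ : A →ₐ[ℂ] Matrix (I ⊕ Unit) (I ⊕ Unit) ℂ, ∀ a,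
      ρ a = Matrix.fromBlocks (Matrix.of fun i j => f i j a) (Matrix.of fun i _ => η i a)
        0 (Matrix.of fun _ _ => Coalgebra.counit (R := ℂ) a)

/-- `R² = 1`, and for all `x`: `x (R + 1) = 0` iff `B` has a relation
`∑ x_ij p_i p_j + ∑ b_i p_i + c = 0` with `b_i, c ∈ A`, i.e. iff `∑ x_ij p_i p_j ∈ Γ`
(as many quadratic relations as possible). -/
def IsMaximal {A B I : Type*} [Ring A] [Bialgebra ℂ A] [Ring B] [Algebra ℂ B]
    [Fintype I] [DecidableEq I] (ι : A →ₐ[ℂ] B) (p : I → B) (Λ : Matrix I I A)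
    (f : I → I → A →ₗ[ℂ] ℂ) : Prop :=
  Rmat f Λ * Rmat f Λ = 1 ∧
    ∀ x : I × I → ℂ, Matrix.vecMul x (Rmat f Λ + 1) = 0 ↔
      ∑ i, ∑ j, x (i, j) • (p i * p j) ∈ Gam ι p

end

end InhomQG

namespace InhomQG
noncomputable section

section Slices

variable {A : Type*} [Ring A] [Bialgebra ℂ A]

lemma eq_of_forall_dual {x y : A} (h : ∀ ρ : A →ₗ[ℂ] ℂ, ρ x = ρ y) : x = y :=
  sub_eq_zero.1 ((Module.forall_dual_apply_eq_zero_iff ℂ _).1 fun ρ => by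
    rw [map_sub, h, sub_self])

lemma actL_of_comul {κ : Type*} [Fintype κ] (ρ : A →ₗ[ℂ] ℂ) {y : A} {b c : κ → A}
    (hy : Coalgebra.comul (R := ℂ) y = ∑ k, b k ⊗ₜ[ℂ] c k) :
    actL ρ y = ∑ k, ρ (c k) • b k := by
  simp [actL, hy]

lemma actR_of_comul {κ : Type*} [Fintype κ] (ρ : A →ₗ[ℂ] ℂ) {y : A} {b c : κ → A}
    (hy : Coalgebra.comul (R := ℂ) y = ∑ k, b k ⊗ₜ[ℂ] c k) :
    actR ρ y = ∑ k, ρ (b k) • c k := by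
  simp [actR, hy]

lemma exists_comul_eq (x : A) : ∃ (n : ℕ) (b c : Fin n → A),
    Coalgebra.comul (R := ℂ) x = ∑ k, b k ⊗ₜ[ℂ] c k := by
  obtain ⟨n, b, c, h⟩ := TensorProduct.exists_sum_tmul_eq (Coalgebra.comul (R := ℂ) x)
  exact ⟨n, b, c, h⟩

lemma dual_actL (f ρ : A →ₗ[ℂ] ℂ) (x : A) : f (actL ρ x) = ρ (actR f x) := by
  obtain ⟨n, b, c, h⟩ := exists_comul_eq x
  simp [actL_of_comul ρ h, actR_of_comul f h, mul_comm]

@[simp] lemma actL_counit (x : A) : actL (Coalgebra.counit (R := ℂ)) x = x := by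
  simp [actL]

@[simp] lemma actR_counit (x : A) : actR (Coalgebra.counit (R := ℂ)) x = x := by
  simp [actR]

@[simp] lemma counit_actL (ρ : A →ₗ[ℂ] ℂ) (x : A) :
    Coalgebra.counit (R := ℂ) (actL ρ x) = ρ x := by
  rw [dual_actL, actR_counit]

@[simp] lemma counit_actR (ρ : A →ₗ[ℂ] ℂ) (x : A) :
    Coalgebra.counit (R := ℂ) (actR ρ x) = ρ x := by
  rw [← dual_actL, actL_counit]

@[simp] lemma actL_one (ρ : A →ₗ[ℂ] ℂ) : actL ρ (1 : A) = ρ 1 • (1 : A) := by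
  simp [actL, Algebra.TensorProduct.one_def]

lemma actL_mul_right {κ : Type*} [Fintype κ] (ρ : A →ₗ[ℂ] ℂ) (x : A) {y : A} {b c : κ → A}
    (hy : Coalgebra.comul (R := ℂ) y = ∑ k, b k ⊗ₜ[ℂ] c k) :
    actL ρ (x * y) = ∑ k, actL (ρ ∘ₗ LinearMap.mulRight ℂ (c k)) x * b k := by
  obtain ⟨n, b', c', h⟩ := exists_comul_eq x
  have hxy : Coalgebra.comul (R := ℂ) (x * y)
      = ∑ z : Fin n × κ, (b' z.1 * b z.2) ⊗ₜ[ℂ] (c' z.1 * c z.2) := by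
    rw [Bialgebra.comul_mul, h, hy, Finset.sum_mul_sum, Fintype.sum_prod_type]
    simp
  rw [actL_of_comul ρ hxy, Fintype.sum_prod_type_right]
  refine Finset.sum_congr rfl fun k _ => ?_
  rw [actL_of_comul _ h, Finset.sum_mul]
  simp

lemma actL_mul_left {κ : Type*} [Fintype κ] (ρ : A →ₗ[ℂ] ℂ) (x : A) {y : A} {b c : κ → A}
    (hy : Coalgebra.comul (R := ℂ) y = ∑ k, b k ⊗ₜ[ℂ] c k) :
    actL ρ (y * x) = ∑ k, b k * actL (ρ ∘ₗ LinearMap.mulLeft ℂ (c k)) x := by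
  obtain ⟨n, b', c', h⟩ := exists_comul_eq x
  have hxy : Coalgebra.comul (R := ℂ) (y * x)
      = ∑ z : κ × Fin n, (b z.1 * b' z.2) ⊗ₜ[ℂ] (c z.1 * c' z.2) := by
    rw [Bialgebra.comul_mul, h, hy, Finset.sum_mul_sum, Fintype.sum_prod_type]
    simp
  rw [actL_of_comul ρ hxy, Fintype.sum_prod_type]
  refine Finset.sum_congr rfl fun k _ => ?_
  rw [actL_of_comul _ h, Finset.mul_sum]
  simp

lemma actL_map {B : Type*} [Ring B] [Bialgebra ℂ B] (ι : A →ₐc[ℂ] B) (ρ : B →ₗ[ℂ] ℂ) (a : A) :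
    actL ρ (ι a) = ι (actL (ρ ∘ₗ (ι : A →ₐ[ℂ] B).toLinearMap) a) := by
  obtain ⟨n, b, c, h⟩ := exists_comul_eq a
  have h' : Coalgebra.comul (R := ℂ) (ι a) = ∑ k, ι (b k) ⊗ₜ[ℂ] ι (c k) := by
    rw [← CoalgHomClass.map_comp_comul_apply, h]
    simp
  rw [actL_of_comul _ h, actL_of_comul _ h']
  simp

lemma actL_actR (ρ f : A →ₗ[ℂ] ℂ) (x : A) : actL ρ (actR f x) = actR f (actL ρ x) := by
  have h := Coalgebra.coassoc_apply (R := ℂ) x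
  let Φ : A ⊗[ℂ] (A ⊗[ℂ] A) →ₗ[ℂ] A := (TensorProduct.lid ℂ A).toLinearMap ∘ₗ
    TensorProduct.map f ((TensorProduct.rid ℂ A).toLinearMap ∘ₗ LinearMap.lTensor A ρ)
  have h1 : ∀ z : A ⊗[ℂ] A, Φ (LinearMap.lTensor A Coalgebra.comul z)
      = actL ρ ((TensorProduct.lid ℂ A) (LinearMap.rTensor A f z)) := by
    intro z
    induction z with
    | zero => simp
    | tmul a b => simp [Φ, actL]
    | add a b ha hb => simp only [map_add, ha, hb]
  have h2 : ∀ z : A ⊗[ℂ] A, Φ (TensorProduct.assoc ℂ A A A (LinearMap.rTensor A Coalgebra.comul z))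
      = actR f ((TensorProduct.rid ℂ A) (LinearMap.lTensor A ρ z)) := by
    intro z
    induction z with
    | zero => simp
    | tmul a b =>
      obtain ⟨n, b', c', h⟩ := exists_comul_eq a
      simp [Φ, actR, h, TensorProduct.sum_tmul, Finset.smul_sum, smul_smul]
    | add a b ha hb => simp only [map_add, ha, hb]
  have := h1 (Coalgebra.comul x)
  rw [← h, h2] at this
  exact this.symm

lemma actL_actL (σ ρ : A →ₗ[ℂ] ℂ) (x : A) : actL σ (actL ρ x) = actL (ρ ∘ₗ actR σ) x := by
  refine eq_of_forall_dual fun f => ?_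
  rw [dual_actL, ← actL_actR, dual_actL, dual_actL]
  rfl

lemma tensor_eq_of_slices {M N : Type*} [AddCommGroup M] [Module ℂ M] [AddCommGroup N]
    [Module ℂ N] {z z' : M ⊗[ℂ] N}
    (h : ∀ ρ : N →ₗ[ℂ] ℂ, LinearMap.lTensor M ρ z = LinearMap.lTensor M ρ z') : z = z' := by
  classical
  let b := Module.Basis.ofVectorSpace ℂ N
  refine (TensorProduct.equivFinsuppOfBasisRight b).injective (Finsupp.ext fun i => ?_)
  have key : ∀ z : M ⊗[ℂ] N, TensorProduct.equivFinsuppOfBasisRight b z i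
      = TensorProduct.rid ℂ M (LinearMap.lTensor M (b.coord i) z) := by
    intro z
    induction z with
    | zero => simp
    | tmul a b => simp
    | add a b ha hb => simp only [map_add, Finsupp.add_apply, ha, hb]
  rw [key, key, h]

lemma comul_eq_of_actL {κ : Type*} [Fintype κ] {y : A} {b c : κ → A}
    (h : ∀ ρ : A →ₗ[ℂ] ℂ, actL ρ y = ∑ k, ρ (c k) • b k) :
    Coalgebra.comul (R := ℂ) y = ∑ k, b k ⊗ₜ[ℂ] c k := by
  refine tensor_eq_of_slices fun ρ => (TensorProduct.rid ℂ A).injective ?_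
  have := h ρ
  simp only [actL, LinearMap.comp_apply, LinearEquiv.coe_coe] at this
  rw [this]
  simp

lemma IsRep.actL {n : Type*} [Fintype n] [DecidableEq n] {w : Matrix n n A} (hw : IsRep w)
    (ρ : A →ₗ[ℂ] ℂ) (c d : n) : actL ρ (w c d) = ∑ e, ρ (w e d) • w c e :=
  actL_of_comul ρ (hw.1 c d)

lemma IsRep.actR {n : Type*} [Fintype n] [DecidableEq n] {w : Matrix n n A} (hw : IsRep w)
    (ρ : A →ₗ[ℂ] ℂ) (c d : n) : actR ρ (w c d) = ∑ e, ρ (w c e) • w e d :=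
  actR_of_comul ρ (hw.1 c d)

end Slices

section Comodules

variable (A : Type*) [Ring A] [Bialgebra ℂ A]

/-- The algebra of operators on `A` generated by the maps `a ↦ ρ * a`. -/
def actSubalgebra : Subalgebra ℂ (Module.End ℂ A) :=
  Algebra.adjoin ℂ (Set.range (actL : (A →ₗ[ℂ] ℂ) → Module.End ℂ A))

/-- `actSubalgebra A` as a ring in its own right. -/
def actAlg : Type _ := actSubalgebra A

instance : Ring (actAlg A) := (actSubalgebra A).toRing

instance : Algebra ℂ (actAlg A) := (actSubalgebra A).algebra

/-- The inclusion of `actAlg A` into the linear endomorphisms of `A`. -/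
def actAlgVal : actAlg A →ₐ[ℂ] Module.End ℂ A := (actSubalgebra A).val

instance : Module (actAlg A) A := Module.compHom A (actAlgVal A).toRingHom

variable {A}

lemma actAlg_smul_def (T : actAlg A) (x : A) : T • x = actAlgVal A T x := rfl

instance : IsScalarTower ℂ (actAlg A) A where
  smul_assoc c T x := by simp [actAlg_smul_def]

lemma actL_mem_submodule (W : Submodule (actAlg A) A) (ρ : A →ₗ[ℂ] ℂ) {x : A} (hx : x ∈ W) :
    actL ρ x ∈ W :=
  W.smul_mem (⟨actL ρ, Algebra.subset_adjoin ⟨ρ, rfl⟩⟩ : actSubalgebra A) hx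

/-- A subspace stable under all `a ↦ ρ * a`, as an `actAlg A`-submodule. -/
def stableSubmodule (W : Submodule ℂ A) (hW : ∀ ρ, ∀ x ∈ W, actL ρ x ∈ W) :
    Submodule (actAlg A) A where
  toAddSubmonoid := W.toAddSubmonoid
  smul_mem' := by
    rintro ⟨T, hT⟩ x hx
    have : ∀ x ∈ W, T x ∈ W := by
      induction hT using Algebra.adjoin_induction with
      | mem T h => obtain ⟨ρ, rfl⟩ := h; exact hW ρ
      | algebraMap r => intro x hx; exact W.smul_mem r hx
      | add S T _ _ hS hT => intro x hx; exact W.add_mem (hS x hx) (hT x hx)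
      | mul S T _ _ hS hT => intro x hx; exact hS _ (hT x hx)
    exact this x hx

lemma mem_stableSubmodule {W : Submodule ℂ A} {hW : ∀ ρ, ∀ x ∈ W, actL ρ x ∈ W} {x : A} :
    x ∈ stableSubmodule W hW ↔ x ∈ W := Iff.rfl

lemma exists_finite_stable (x : A) : ∃ W : Submodule (actAlg A) A, x ∈ W ∧
    FiniteDimensional ℂ (W.restrictScalars ℂ) := by
  let V : Submodule ℂ A := Submodule.span ℂ (Set.range fun ρ : A →ₗ[ℂ] ℂ => actL ρ x)
  have hV : ∀ ρ, ∀ y ∈ V, actL ρ y ∈ V := by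
    intro σ y hy
    induction hy using Submodule.span_induction with
    | mem y h =>
      obtain ⟨ρ, rfl⟩ := h
      exact Submodule.subset_span ⟨_, (actL_actL σ ρ x).symm⟩
    | zero => simp
    | add y z _ _ hy hz => rw [map_add]; exact V.add_mem hy hz
    | smul c y _ hy => rw [map_smul]; exact V.smul_mem c hy
  refine ⟨stableSubmodule V hV, Submodule.subset_span ⟨Coalgebra.counit, by simp⟩, ?_⟩
  obtain ⟨n, b, c, h⟩ := exists_comul_eq x
  have hle : V ≤ Submodule.span ℂ (Set.range b) := by
    refine Submodule.span_le.2 ?_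
    rintro _ ⟨ρ, rfl⟩
    simp only [actL_of_comul ρ h, SetLike.mem_coe]
    exact Submodule.sum_mem _ fun k _ => Submodule.smul_mem _ _ (Submodule.subset_span ⟨k, rfl⟩)
  have : FiniteDimensional ℂ (Submodule.span ℂ (Set.range b)) :=
    FiniteDimensional.span_of_finite ℂ (Set.finite_range b)
  exact Submodule.finiteDimensional_of_le hle

/-- The matrix of the comodule `V` in a basis. -/
lemma exists_rep_of_basis {n : ℕ} (V : Submodule (actAlg A) A)
    (e : Module.Basis (Fin n) ℂ (V.restrictScalars ℂ)) :
    ∃ w : Matrix (Fin n) (Fin n) A, IsRep w ∧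
      ∀ (ρ : A →ₗ[ℂ] ℂ) d, actL ρ (e d : A) = ∑ c, ρ (w c d) • (e c : A) := by
  have hext : ∀ c, ∃ g : A →ₗ[ℂ] ℂ, g ∘ₗ (V.restrictScalars ℂ).subtype = e.coord c :=
    fun c => LinearMap.exists_extend (e.coord c)
  choose g hg using hext
  have hg' : ∀ c (x : V.restrictScalars ℂ), g c x = e.repr x c := fun c x =>
    LinearMap.congr_fun (hg c) x
  let w : Matrix (Fin n) (Fin n) A := Matrix.of fun c d => actR (g c) (e d : A)
  have hw : ∀ (ρ : A →ₗ[ℂ] ℂ) d, actL ρ (e d : A) = ∑ c, ρ (w c d) • (e c : A) := by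
    intro ρ d
    have hmem : actL ρ (e d : A) ∈ V := actL_mem_submodule V ρ (e d).2
    have h1 := congrArg Subtype.val (e.sum_repr ⟨actL ρ (e d : A), hmem⟩)
    simp only [Submodule.coe_sum, Submodule.coe_smul, ← hg'] at h1
    rw [← h1]
    refine Finset.sum_congr rfl fun c _ => ?_
    rw [dual_actL]
    rfl
  refine ⟨w, ⟨fun c d => comul_eq_of_actL fun ρ => ?_, fun c d => ?_⟩, hw⟩
  · simp only [w, Matrix.of_apply]
    rw [actL_actR, hw, map_sum]
    simp [w]
  · simp only [w, Matrix.of_apply, counit_actR, hg']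
    simp [Matrix.one_apply, Finsupp.single_apply, eq_comm]

/-- The subspace of `V` with coordinates in an invariant subspace. -/
def coordSubmodule {n : ℕ} (V : Submodule (actAlg A) A)
    (e : Module.Basis (Fin n) ℂ (V.restrictScalars ℂ)) {w : Matrix (Fin n) (Fin n) A}
    (hw : ∀ (ρ : A →ₗ[ℂ] ℂ) d, actL ρ (e d : A) = ∑ c, ρ (w c d) • (e c : A))
    (W : Submodule ℂ (Fin n → ℂ)) (hW : IsInvariant w W) : Submodule (actAlg A) A :=
  stableSubmodule ((W.map e.equivFun.symm.toLinearMap).map (V.restrictScalars ℂ).subtype) <| by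
    rintro ρ _ ⟨_, ⟨x, hx, rfl⟩, rfl⟩
    refine ⟨_, ⟨_, hW ρ x hx, rfl⟩, ?_⟩
    simp only [LinearEquiv.coe_coe, Submodule.subtype_apply, Module.Basis.equivFun_symm_apply,
      map_sum, map_smul, hw, Matrix.mulVec, dotProduct,
      Matrix.map_apply, Finset.sum_smul, Finset.smul_sum, smul_smul]
    rw [Finset.sum_comm]
    simp [mul_comm]

lemma mem_coordSubmodule {n : ℕ} {V : Submodule (actAlg A) A}
    {e : Module.Basis (Fin n) ℂ (V.restrictScalars ℂ)} {w : Matrix (Fin n) (Fin n) A}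
    {hw : ∀ (ρ : A →ₗ[ℂ] ℂ) d, actL ρ (e d : A) = ∑ c, ρ (w c d) • (e c : A)}
    {W : Submodule ℂ (Fin n → ℂ)} {hW : IsInvariant w W} {x : A} :
    x ∈ coordSubmodule V e hw W hW ↔ ∃ y ∈ W, (e.equivFun.symm y : A) = x := by
  simp only [coordSubmodule, mem_stableSubmodule, Submodule.mem_map, LinearEquiv.coe_coe,
    exists_exists_and_eq_and, Submodule.subtype_apply]

lemma isInvariant_comap {n : ℕ} {V : Submodule (actAlg A) A}
    {e : Module.Basis (Fin n) ℂ (V.restrictScalars ℂ)} {w : Matrix (Fin n) (Fin n) A}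
    (hw : ∀ (ρ : A →ₗ[ℂ] ℂ) d, actL ρ (e d : A) = ∑ c, ρ (w c d) • (e c : A))
    (U : Submodule (actAlg A) A) :
    IsInvariant w ((U.restrictScalars ℂ).comap
      ((V.restrictScalars ℂ).subtype ∘ₗ e.equivFun.symm.toLinearMap)) := by
  intro ρ x hx
  simp only [Submodule.mem_comap, Submodule.restrictScalars_mem] at hx ⊢
  convert actL_mem_submodule U ρ hx using 1
  simp only [LinearMap.comp_apply, LinearEquiv.coe_coe, Submodule.subtype_apply,
    Module.Basis.equivFun_symm_apply,
    map_sum, map_smul, hw, Matrix.mulVec, dotProduct,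
    Matrix.map_apply, Finset.sum_smul, Finset.smul_sum, smul_smul]
  rw [Finset.sum_comm]
  simp [mul_comm]

lemma isSemisimpleModule_of_finite
    (hcr : ∀ (n : ℕ) (v : Matrix (Fin n) (Fin n) A), IsRep v → IsCompletelyReducible v)
    (V : Submodule (actAlg A) A) [FiniteDimensional ℂ (V.restrictScalars ℂ)] :
    IsSemisimpleModule (actAlg A) V := by
  let e := Module.finBasis ℂ (V.restrictScalars ℂ)
  obtain ⟨w, hrep, hw⟩ := exists_rep_of_basis V e
  rw [isSemisimpleModule_iff]
  refine ⟨fun U => ?_⟩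
  obtain ⟨W', hW', hc⟩ := hcr _ w hrep _ (isInvariant_comap hw (U.map V.subtype))
  refine ⟨(coordSubmodule V e hw W' hW').comap V.subtype, ?_⟩
  rw [isCompl_iff, Submodule.disjoint_def, Submodule.codisjoint_iff_exists_add_eq]
  rw [isCompl_iff, Submodule.disjoint_def, Submodule.codisjoint_iff_exists_add_eq] at hc
  constructor
  · intro x hx hx'
    rw [Submodule.mem_comap, mem_coordSubmodule] at hx'
    obtain ⟨y, hy, hyx⟩ := hx'
    have h0 : y = 0 := hc.1 y (by
      simp only [Submodule.mem_comap, LinearMap.comp_apply, LinearEquiv.coe_coe,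
        Submodule.subtype_apply, Submodule.restrictScalars_mem]
      rw [hyx]
      exact ⟨x, hx, rfl⟩) hy
    refine Subtype.ext ?_
    simpa [h0] using hyx.symm
  · intro x
    obtain ⟨y, z, hy, hz, hyz⟩ := hc.2 (e.equivFun (⟨x.1, x.2⟩ : V.restrictScalars ℂ))
    obtain ⟨y', hy', hyy⟩ := hy
    refine ⟨y', ⟨(e.equivFun.symm z : A), (e.equivFun.symm z).2⟩, hy', ?_, ?_⟩
    · rw [Submodule.mem_comap, mem_coordSubmodule]
      exact ⟨z, hz, rfl⟩
    · refine Subtype.ext ?_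
      have := congrArg (fun t => (e.equivFun.symm t : A)) hyz
      rw [map_add, e.equivFun.symm_apply_apply, Submodule.coe_add] at this
      refine Eq.trans ?_ this
      exact congrArg (· + (e.equivFun.symm z : A)) hyy

lemma isSemisimpleModule_actAlg
    (hcr : ∀ (n : ℕ) (v : Matrix (Fin n) (Fin n) A), IsRep v → IsCompletelyReducible v) :
    IsSemisimpleModule (actAlg A) A := by
  choose V hV hfin using exists_finite_stable (A := A)
  refine isSemisimpleModule_of_isSemisimpleModule_submodule' (p := V)
    (fun x => isSemisimpleModule_of_finite hcr (V x)) (eq_top_iff.2 fun x _ => ?_)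
  exact Submodule.mem_iSup_of_mem x (hV x)

/-- `A` is spanned by the matrix elements of its irreducible representations. -/
lemma span_irrep_eq_top
    (hcr : ∀ (n : ℕ) (v : Matrix (Fin n) (Fin n) A), IsRep v → IsCompletelyReducible v) :
    Submodule.span ℂ {a : A | ∃ (n : ℕ) (w : Matrix (Fin n) (Fin n) A), IsIrrep w ∧
      ∃ c d, w c d = a} = ⊤ := by
  have hss := isSemisimpleModule_actAlg hcr
  have htop := IsSemisimpleModule.sSup_simples_eq_top (actAlg A) A
  set S := Submodule.span ℂ {a : A | ∃ (n : ℕ) (w : Matrix (Fin n) (Fin n) A), IsIrrep w ∧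
      ∃ c d, w c d = a} with hS
  have hsimple : ∀ V : Submodule (actAlg A) A, IsSimpleModule (actAlg A) V → ∀ x ∈ V, x ∈ S := by
    intro V hV x hx
    have hfin : FiniteDimensional ℂ (V.restrictScalars ℂ) := by
      obtain ⟨y, hy, hy0⟩ := (Submodule.ne_bot_iff V).1 (isSimpleModule_iff_isAtom.1 hV).1
      obtain ⟨W, hyW, hW⟩ := exists_finite_stable y
      have hle : V ≤ W := by
        rcases (isSimpleModule_iff_isAtom.1 hV).le_iff.1 (inf_le_left : V ⊓ W ≤ V) with h | h
        · exact absurd ((Submodule.eq_bot_iff _).1 h y ⟨hy, hyW⟩) hy0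
        · exact inf_eq_left.1 h
      exact Submodule.finiteDimensional_of_le (S₂ := W.restrictScalars ℂ) hle
    let e := Module.finBasis ℂ (V.restrictScalars ℂ)
    obtain ⟨w, hrep, hw⟩ := exists_rep_of_basis V e
    have hirr : IsIrrep w := by
      refine ⟨hrep, ?_, fun W hW => ?_⟩
      · by_contra hne
        rw [not_nonempty_iff] at hne
        refine (isSimpleModule_iff_isAtom.1 hV).1 ((Submodule.eq_bot_iff V).2 fun y hy => ?_)
        have := e.sum_repr ⟨y, hy⟩
        rw [Finset.univ_eq_empty, Finset.sum_empty] at this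
        exact (congrArg Subtype.val this).symm
      · have hle : coordSubmodule V e hw W hW ≤ V := by
          intro y hy
          obtain ⟨z, _, rfl⟩ := mem_coordSubmodule.1 hy
          exact (e.equivFun.symm z).2
        rcases (isSimpleModule_iff_isAtom.1 hV).le_iff.1 hle with h | h
        · left
          refine (Submodule.eq_bot_iff W).2 fun z hz => ?_
          have h0 : (e.equivFun.symm z : A) ∈ coordSubmodule V e hw W hW :=
            mem_coordSubmodule.2 ⟨z, hz, rfl⟩
          rw [h, Submodule.mem_bot] at h0
          exact (LinearEquiv.map_eq_zero_iff _).1 (Subtype.ext h0)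
        · right
          refine eq_top_iff.2 fun z _ => ?_
          have h0 : (e.equivFun.symm z : A) ∈ coordSubmodule V e hw W hW :=
            h.ge (e.equivFun.symm z).2
          obtain ⟨z', hz', h1⟩ := mem_coordSubmodule.1 h0
          rwa [← e.equivFun.symm.injective (Subtype.ext h1)]
    have hentry : ∀ d, (e d : A) ∈ S := by
      intro d
      have : (e d : A) = ∑ c, (Coalgebra.counit (R := ℂ) (e c : A)) • w c d := by
        refine eq_of_forall_dual fun ρ => ?_
        rw [← counit_actL ρ (e d : A), hw]
        simp [mul_comm]
      rw [this]
      exact S.sum_mem fun c _ => S.smul_mem _ (Submodule.subset_span ⟨_, w, hirr, c, d, rfl⟩)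
    have h1 := congrArg Subtype.val (e.sum_repr ⟨x, hx⟩)
    simp only [Submodule.coe_sum, Submodule.coe_smul] at h1
    rw [← h1]
    exact S.sum_mem fun c _ => S.smul_mem _ (hentry c)
  refine eq_top_iff.2 fun x _ => ?_
  have hx : x ∈ sSup {m : Submodule (actAlg A) A | IsSimpleModule (actAlg A) m} := by
    rw [htop]; trivial
  rw [sSup_eq_iSup'] at hx
  induction hx using Submodule.iSup_induction' with
  | mem V y hy => exact hsimple V.1 V.2 y hy
  | zero => exact S.zero_mem
  | add y z _ _ hy hz => exact S.add_mem (hy trivial) (hz trivial)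

end Comodules

section Haar

variable {A : Type*} [Ring A] [Bialgebra ℂ A]

lemma linearMap_ext_irrep
    (hcr : ∀ (n : ℕ) (v : Matrix (Fin n) (Fin n) A), IsRep v → IsCompletelyReducible v)
    {M : Type*} [AddCommGroup M] [Module ℂ M] {f g : A →ₗ[ℂ] M}
    (h : ∀ (n : ℕ) (w : Matrix (Fin n) (Fin n) A), IsIrrep w → ∀ c d, f (w c d) = g (w c d)) :
    f = g :=
  LinearMap.ext_on (span_irrep_eq_top hcr) <| by
    rintro _ ⟨n, w, hw, c, d, rfl⟩
    exact h n w hw c d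

lemma exists_haar
    (hcr : ∀ (n : ℕ) (v : Matrix (Fin n) (Fin n) A), IsRep v → IsCompletelyReducible v) :
    ∃ χ : A →ₗ[ℂ] ℂ, χ 1 = 1 ∧ ∀ a, actL χ a = χ a • (1 : A) := by
  have hss := isSemisimpleModule_actAlg hcr
  let U : Submodule (actAlg A) A := stableSubmodule (Submodule.span ℂ {1}) <| by
    intro ρ x hx
    obtain ⟨c, rfl⟩ := Submodule.mem_span_singleton.1 hx
    rw [map_smul, actL_one, smul_smul]
    exact Submodule.smul_mem _ _ (Submodule.mem_span_singleton_self _)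
  obtain ⟨h, hh⟩ := IsSemisimpleModule.extension_property U.subtype U.injective_subtype
    LinearMap.id
  let χ : A →ₗ[ℂ] ℂ := Coalgebra.counit ∘ₗ (U.subtype ∘ₗ h).restrictScalars ℂ
  have hχ : ∀ a, (h a : A) = χ a • (1 : A) := by
    intro a
    obtain ⟨c, hc⟩ := Submodule.mem_span_singleton.1 (show (h a : A) ∈ Submodule.span ℂ {1} from
      (h a).2)
    have : χ a = c := by simp [χ, ← hc]
    rw [this, hc]
  have hχ1 : χ 1 = 1 := by
    have h1 : (1 : A) ∈ U := Submodule.mem_span_singleton_self _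
    have h2 : (h 1 : A) = 1 := congrArg Subtype.val (LinearMap.congr_fun hh ⟨1, h1⟩)
    simp [χ, h2]
  have hR : ∀ a, actR χ a = χ a • (1 : A) := by
    intro a
    refine eq_of_forall_dual fun ρ => ?_
    rw [← dual_actL, ← hχ]
    have h1 : (h (actL ρ a) : A) = actL ρ (h a : A) := by
      have := h.map_smul (⟨actL ρ, Algebra.subset_adjoin ⟨ρ, rfl⟩⟩ : actSubalgebra A) a
      exact congrArg Subtype.val this
    simp [χ, h1]
  refine ⟨χ, hχ1, fun a => ?_⟩
  suffices h : actL χ = χ.smulRight (1 : A) from LinearMap.congr_fun h a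
  refine linearMap_ext_irrep hcr fun n w hw c d => ?_
  rw [hw.1.actL, LinearMap.smulRight_apply]
  have hrow : ∀ c d, ∑ e, χ (w c e) • w e d = χ (w c d) • (1 : A) := fun c d => by
    rw [← hw.1.actR, hR]
  have hinv : ∀ (c : Fin n) (φ : A →ₗ[ℂ] ℂ) (x : Fin n → ℂ),
      ∑ e, χ (w c e) * (w.map φ).mulVec x e = φ 1 * ∑ e, χ (w c e) * x e := by
    intro c φ x
    have h1 : ∀ d, ∑ e, χ (w c e) * φ (w e d) = χ (w c d) * φ 1 := fun d => by
      simpa using congrArg φ (hrow c d)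
    simp only [Matrix.mulVec, dotProduct, Matrix.map_apply, Finset.mul_sum]
    rw [Finset.sum_comm]
    refine Finset.sum_congr rfl fun d _ => ?_
    rw [← mul_assoc, mul_comm (φ 1), ← h1, Finset.sum_mul]
    exact Finset.sum_congr rfl fun e _ => by ring
  by_cases h0 : ∀ c e, χ (w c e) = 0
  · simp [h0]
  · push Not at h0
    obtain ⟨c₀, e₀, h0⟩ := h0
    let r : (Fin n → ℂ) →ₗ[ℂ] ℂ := ∑ e, χ (w c₀ e) • LinearMap.proj e
    have hr : ∀ x, r x = ∑ e, χ (w c₀ e) * x e := fun x => by simp [r]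
    have hker : LinearMap.ker r = ⊥ := by
      refine (hw.2.2 (LinearMap.ker r) fun φ x hx => ?_).resolve_right fun htop => h0 ?_
      · rw [LinearMap.mem_ker, hr] at hx ⊢
        rw [hinv, hx, mul_zero]
      · have : r (Pi.single e₀ 1) = 0 := by
          rw [← LinearMap.mem_ker, htop]; trivial
        rw [hr] at this
        simpa [Pi.single_apply] using this
    have hw1 : ∀ c d, w c d = (1 : Matrix (Fin n) (Fin n) ℂ) c d • (1 : A) := by
      intro c d
      refine eq_of_forall_dual fun φ => ?_
      have h1 : (w.map φ).mulVec (Pi.single d 1) = φ 1 • Pi.single d 1 := by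
        refine LinearMap.ker_eq_bot.1 hker ?_
        rw [hr, hinv, map_smul, hr, smul_eq_mul]
      have := congrFun h1 c
      rw [map_smul, Matrix.one_apply, smul_eq_mul]
      simpa [Pi.single_apply] using this
    simp only [hw1, map_smul, hχ1, smul_smul]
    simp [Matrix.one_apply]

end Haar

section Intertwiners

variable {A I : Type*} [Ring A]

lemma IsRep.antipode_mul [HopfAlgebra ℂ A] {n : Type*} [Fintype n] [DecidableEq n]
    {w : Matrix n n A} (hw : IsRep w) (c d : n) :
    ∑ e, HopfAlgebra.antipode ℂ (w c e) * w e d = (1 : Matrix n n ℂ) c d • (1 : A) := by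
  have := HopfAlgebra.mul_antipode_rTensor_comul_apply (R := ℂ) (w c d)
  rw [hw.1, hw.2, Algebra.algebraMap_eq_smul_one] at this
  simpa using this

lemma IsRep.mul_antipode [HopfAlgebra ℂ A] {n : Type*} [Fintype n] [DecidableEq n]
    {w : Matrix n n A} (hw : IsRep w) (c d : n) :
    ∑ e, w c e * HopfAlgebra.antipode ℂ (w e d) = (1 : Matrix n n ℂ) c d • (1 : A) := by
  have := HopfAlgebra.mul_antipode_lTensor_comul_apply (R := ℂ) (w c d)
  rw [hw.1, hw.2, Algebra.algebraMap_eq_smul_one] at this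
  simpa using this

lemma IsRep.comul_antipode [HopfAlgebra ℂ A] {n : Type*} [Fintype n] [DecidableEq n]
    {w : Matrix n n A} (hw : IsRep w) (c d : n) :
    Coalgebra.comul (R := ℂ) (HopfAlgebra.antipode ℂ (w c d)) =
      ∑ e, HopfAlgebra.antipode ℂ (w e d) ⊗ₜ[ℂ] HopfAlgebra.antipode ℂ (w c e) := by
  let M : Matrix n n (A ⊗[ℂ] A) := Matrix.of fun c d => ∑ e, w c e ⊗ₜ[ℂ] w e d
  let N : Matrix n n (A ⊗[ℂ] A) :=
    Matrix.of fun c d => ∑ e, HopfAlgebra.antipode ℂ (w e d) ⊗ₜ[ℂ] HopfAlgebra.antipode ℂ (w c e)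
  let N' : Matrix n n (A ⊗[ℂ] A) :=
    Matrix.of fun c d => Coalgebra.comul (R := ℂ) (HopfAlgebra.antipode ℂ (w c d))
  have h1 : N' * M = 1 := by
    ext c d
    have := congrArg (Bialgebra.comulAlgHom ℂ A) (hw.antipode_mul c d)
    simp only [map_sum, map_mul, Bialgebra.comulAlgHom_apply, map_smul, hw.1, map_one] at this
    simp only [Matrix.mul_apply, N', M, Matrix.of_apply]
    rw [this]
    simp [Matrix.one_apply]
  have h2 : M * N = 1 := by
    ext c d
    simp only [Matrix.mul_apply, N, M, Matrix.of_apply, Finset.sum_mul_sum,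
      Algebra.TensorProduct.tmul_mul_tmul]
    have h3 : ∀ x x' : n, ∑ e, (w c x * HopfAlgebra.antipode ℂ (w x' d)) ⊗ₜ[ℂ]
        (w x e * HopfAlgebra.antipode ℂ (w e x')) =
        (w c x * HopfAlgebra.antipode ℂ (w x' d)) ⊗ₜ[ℂ] ((1 : Matrix n n ℂ) x x' • (1 : A)) := by
      intro x x'
      rw [← TensorProduct.tmul_sum, hw.mul_antipode]
    rw [Finset.sum_comm]
    simp_rw [Finset.sum_comm (s := (Finset.univ : Finset n)) (t := Finset.univ)
      (f := fun (e x' : n) => (w c _ * HopfAlgebra.antipode ℂ (w x' d)) ⊗ₜ[ℂ]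
        (w _ e * HopfAlgebra.antipode ℂ (w e x'))), h3]
    simp only [Matrix.one_apply, ite_smul, one_smul, zero_smul, apply_ite, TensorProduct.tmul_zero,
      Finset.sum_ite_eq, Finset.mem_univ, if_true]
    rw [← TensorProduct.sum_tmul, hw.mul_antipode, Matrix.one_apply]
    split_ifs <;> simp [Algebra.TensorProduct.one_def]
  exact congrArg (fun X : Matrix n n (A ⊗[ℂ] A) => X c d) (left_inv_eq_right_inv h1 h2)

lemma isIrrep_reindex [Bialgebra ℂ A] {J K : Type*} [Fintype J] [DecidableEq J] [Fintype K]
    [DecidableEq K] (e : K ≃ J) {w : Matrix J J A} (hw : IsIrrep w) :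
    IsIrrep (w.submatrix e e) := by
  obtain ⟨hrep, hne, hirr⟩ := hw
  refine ⟨⟨fun i j => ?_, fun i j => ?_⟩, e.nonempty, fun W hW => ?_⟩
  · simp only [Matrix.submatrix_apply, hrep.1]
    exact (e.sum_comp fun k => w (e i) k ⊗ₜ[ℂ] w k (e j)).symm
  · simp [hrep.2, Matrix.one_apply]
  · have h := hirr (W.comap (LinearMap.funLeft ℂ ℂ e)) fun φ x hx => by
      rw [Submodule.mem_comap] at hx ⊢
      convert hW φ _ hx using 1
      ext k
      simp only [LinearMap.funLeft_apply, Matrix.mulVec, dotProduct, Matrix.map_apply,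
        Matrix.submatrix_apply]
      exact (e.sum_comp fun j => φ (w (e k) j) * x j).symm
    have hsurj : Function.Surjective (LinearMap.funLeft ℂ ℂ e : (J → ℂ) →ₗ[ℂ] (K → ℂ)) :=
      LinearMap.funLeft_surjective_of_injective ℂ ℂ e e.injective
    rcases h with h | h
    · left
      refine (Submodule.eq_bot_iff W).2 fun x hx => ?_
      obtain ⟨y, rfl⟩ := hsurj x
      have : y ∈ W.comap (LinearMap.funLeft ℂ ℂ e) := hx
      rw [h, Submodule.mem_bot] at this
      rw [this, map_zero]
    · right
      refine eq_top_iff.2 fun x _ => ?_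
      obtain ⟨y, rfl⟩ := hsurj x
      have : y ∈ W.comap (LinearMap.funLeft ℂ ℂ e) := by rw [h]; trivial
      exact this

lemma one_fin_one_apply {R : Type*} [Zero R] [One R] (i j : Fin 1) :
    (1 : Matrix (Fin 1) (Fin 1) R) i j = 1 := by
  rw [Subsingleton.elim i j, Matrix.one_apply_eq]

lemma isIrrep_one [Bialgebra ℂ A] : IsIrrep (1 : Matrix (Fin 1) (Fin 1) A) := by
  refine ⟨⟨fun i j => ?_, fun i j => ?_⟩, inferInstance, fun W _ => ?_⟩
  · simp [one_fin_one_apply, Algebra.TensorProduct.one_def]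
  · simp [one_fin_one_apply]
  · have : IsSimpleOrder (Submodule ℂ (Fin 1 → ℂ)) :=
      (isSimpleModule_iff ..).1
        ((LinearEquiv.funUnique (Fin 1) ℂ ℂ).isSimpleModule_iff.2 inferInstance)
    exact eq_bot_or_eq_top W

variable [HopfAlgebra ℂ A] [Fintype I] [DecidableEq I] {Λ : Matrix I I A}

lemma HomogeneousData.isRep (hΛ : HomogeneousData Λ) : IsRep Λ := hΛ.irreducible.1

lemma HomogeneousData.intertwiner_tensor_eq_zero (hΛ : HomogeneousData Λ) {m n : ℕ}
    {v : Matrix (Fin m) (Fin m) A} {w : Matrix (Fin n) (Fin n) A} (hv : IsIrrep v) (hw : IsIrrep w)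
    (M : I → Fin m × Fin n → Fin m × Fin n → ℂ)
    (h : ∀ i z y, ∑ x, M i z x • (v x.1 y.1 * w x.2 y.2) =
      ∑ t, ∑ x, M t x y • (Λ i t * (v z.1 x.1 * w z.2 x.2))) (i z y) : M i z y = 0 := by
  have := hΛ.mor_eq_zero m n v w hv hw (Matrix.of fun x y => M x.1 x.2 y) (by
    ext ⟨i, z⟩ y
    simp only [scal, Matrix.mul_apply, Matrix.map_apply, Matrix.of_apply,
      Matrix.kroneckerMap_apply, ← Algebra.smul_def, ← Algebra.commutes]
    rw [h, Fintype.sum_prod_type])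
  exact congrFun (congrFun this (i, z)) y

lemma HomogeneousData.intertwiner_eq_zero (hΛ : HomogeneousData Λ) {J : Type*} [Fintype J]
    [DecidableEq J] {w : Matrix J J A} (hw : IsIrrep w) (M : I → J → J → ℂ)
    (h : ∀ i c d, ∑ e, M i c e • w e d = ∑ t, ∑ e, M t e d • (Λ i t * w c e)) (i c d) :
    M i c d = 0 := by
  let e := (Fintype.equivFin J).symm
  have := hΛ.intertwiner_tensor_eq_zero isIrrep_one (isIrrep_reindex e hw)
    (fun i x y => M i (e x.2) (e y.2)) (fun i z y => by
      simp only [Fintype.sum_prod_type, Matrix.submatrix_apply, Finset.univ_unique,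
        Finset.sum_singleton, one_fin_one_apply, one_mul]
      rw [e.sum_comp fun k => M i (e z.2) k • w k (e y.2), h]
      refine Finset.sum_congr rfl fun t _ => ?_
      exact (e.sum_comp fun k => M t k (e y.2) • (Λ i t * w (e z.2) k)).symm) i
      (0, e.symm c) (0, e.symm d)
  simpa using this

end Intertwiners

section Freeness

variable {A B I : Type*} [Ring A] [Ring B] [Fintype I] [DecidableEq I]

lemma actR_map [Bialgebra ℂ A] [Bialgebra ℂ B] (ι : A →ₐc[ℂ] B) (ρ : B →ₗ[ℂ] ℂ) (a : A) :
    actR ρ (ι a) = ι (actR (ρ ∘ₗ (ι : A →ₐ[ℂ] B).toLinearMap) a) := by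
  obtain ⟨n, b, c, h⟩ := exists_comul_eq a
  have h' : Coalgebra.comul (R := ℂ) (ι a) = ∑ k, ι (b k) ⊗ₜ[ℂ] ι (c k) := by
    rw [← CoalgHomClass.map_comp_comul_apply, h]
    simp
  rw [actR_of_comul _ h, actR_of_comul _ h']
  simp

section Bialg

variable [Bialgebra ℂ A] [Bialgebra ℂ B] {Λ : Matrix I I A} {ι : A →ₐc[ℂ] B} {p : I → B}

lemma IsInhomogeneous.comul_p (hB : IsInhomogeneous Λ ι p) (i : I) :
    Coalgebra.comul (R := ℂ) (p i) =
      ∑ k : I ⊕ Unit, Sum.elim (fun u => ι (Λ i u)) (fun _ => p i) k ⊗ₜ[ℂ]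
        Sum.elim p (fun _ => 1) k := by
  have := hB.isRep.1 (Sum.inl i) (Sum.inr ())
  simpa [Pmat] using this

lemma IsInhomogeneous.actL_p (hB : IsInhomogeneous Λ ι p) (ρ : B →ₗ[ℂ] ℂ) (i : I) :
    actL ρ (p i) = ∑ u, ρ (p u) • ι (Λ i u) + ρ 1 • p i := by
  rw [actL_of_comul ρ (hB.comul_p i)]
  simp

lemma IsInhomogeneous.actR_p (hB : IsInhomogeneous Λ ι p) (ρ : B →ₗ[ℂ] ℂ) (i : I) :
    actR ρ (p i) = ∑ u, ρ (ι (Λ i u)) • p u + ρ (p i) • 1 := by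
  rw [actR_of_comul ρ (hB.comul_p i)]
  simp

lemma IsInhomogeneous.actL_mul_p (hB : IsInhomogeneous Λ ι p) (ρ : B →ₗ[ℂ] ℂ) (x : B) (i : I) :
    actL ρ (x * p i) =
      ∑ u, actL (ρ ∘ₗ LinearMap.mulRight ℂ (p u)) x * ι (Λ i u) + actL ρ x * p i := by
  rw [actL_mul_right ρ x (hB.comul_p i)]
  simp

lemma IsInhomogeneous.actL_p_mul (hB : IsInhomogeneous Λ ι p) (ρ : B →ₗ[ℂ] ℂ) (x : B) (i : I) :
    actL ρ (p i * x) =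
      ∑ u, ι (Λ i u) * actL (ρ ∘ₗ LinearMap.mulLeft ℂ (p u)) x + p i * actL ρ x := by
  rw [actL_mul_left ρ x (hB.comul_p i)]
  simp

lemma exists_extend_dual {ι : A →ₐc[ℂ] B} (hι : Function.Injective ι) (φ : A →ₗ[ℂ] ℂ) :
    ∃ ρ : B →ₗ[ℂ] ℂ, ∀ a, ρ (ι a) = φ a := by
  obtain ⟨r, hr⟩ := LinearMap.exists_leftInverse_of_injective (ι : A →ₐ[ℂ] B).toLinearMap
    (LinearMap.ker_eq_bot.2 hι)
  exact ⟨φ ∘ₗ r, fun a => congrArg φ (LinearMap.congr_fun hr a)⟩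

end Bialg

variable [HopfAlgebra ℂ A] [Bialgebra ℂ B] {Λ : Matrix I I A} {ι : A →ₐc[ℂ] B} {p : I → B}

/-- The `p_i` are linearly independent modulo `A`. -/
lemma IsInhomogeneous.linearIndependent_mod (hB : IsInhomogeneous Λ ι p) (hΛ : HomogeneousData Λ)
    (x : I → ℂ) (hx : ∑ i, x i • p i ∈ Set.range ι) : x = 0 := by
  let L : (I → ℂ) →ₗ[ℂ] B := ∑ i, (LinearMap.proj i).smulRight (p i)
  have hL : ∀ x, L x = ∑ i, x i • p i := fun x => by simp [L]
  let N : Submodule ℂ (I → ℂ) := (LinearMap.range (ι : A →ₐ[ℂ] B).toLinearMap).comap L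
  have hN : ∀ x, x ∈ N ↔ ∑ i, x i • p i ∈ Set.range ι := fun x => by
    simp only [N, Submodule.mem_comap, hL]
    rfl
  have hstable : ∀ (φ : A →ₗ[ℂ] ℂ), ∀ y ∈ N, (fun j => ∑ i, y i * φ (Λ i j)) ∈ N := by
    intro φ y hy
    obtain ⟨a, ha⟩ := (hN y).1 hy
    obtain ⟨ρ, hρ⟩ := exists_extend_dual hB.injective φ
    refine (hN _).2 ⟨actR (ρ ∘ₗ (ι : A →ₐ[ℂ] B).toLinearMap) a - ρ (∑ i, y i • p i) • 1, ?_⟩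
    rw [map_sub, ← actR_map, ha]
    simp only [map_sum, map_smul, hB.actR_p, hρ, smul_add, Finset.sum_add_distrib, Finset.sum_smul,
      smul_smul, smul_eq_mul, map_one, add_sub_cancel_right, Finset.smul_sum]
    rw [Finset.sum_comm]
  let W : Submodule ℂ (I → ℂ) :=
    { carrier := {x | ∀ y ∈ N, ∑ i, y i * x i = 0}
      add_mem' := fun {a b} ha hb y hy => by
        simp [mul_add, Finset.sum_add_distrib, ha y hy, hb y hy]
      zero_mem' := fun y hy => by simp
      smul_mem' := fun c a ha y hy => by
        simp [mul_left_comm _ c, ← Finset.mul_sum, ha y hy] }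
  have hW : IsInvariant Λ W := by
    intro φ x hx y hy
    have := hx _ (hstable φ y hy)
    simp only [Matrix.mulVec, dotProduct, Matrix.map_apply, Finset.mul_sum]
    rw [Finset.sum_comm, ← this]
    simp only [Finset.sum_mul, mul_assoc]
  rcases hΛ.irreducible.2.2 W hW with h | h
  · exfalso
    have htop : N = ⊤ := by
      by_contra hne
      obtain ⟨f, hf, hle⟩ := Submodule.exists_le_ker_of_lt_top N (lt_top_iff_ne_top.2 hne)
      have hfy : ∀ y : I → ℂ, f y = ∑ i, y i * f (Pi.single i 1) := fun y => by
        conv_lhs => rw [pi_eq_sum_univ' y, map_sum]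
        refine Finset.sum_congr rfl fun i _ => ?_
        rw [map_smul, smul_eq_mul]
      have hmem : (fun i => f (Pi.single i 1)) ∈ W := fun y hy => by
        rw [← hfy]; exact hle hy
      rw [h, Submodule.mem_bot] at hmem
      refine hf (LinearMap.ext fun y => ?_)
      rw [hfy]
      simp [fun i => congrFun hmem i]
    obtain ⟨i, hi⟩ := hB.notMem
    refine hi ?_
    have : (Pi.single i 1 : I → ℂ) ∈ N := by rw [htop]; trivial
    simpa [Pi.single_apply] using (hN _).1 this
  · ext i
    have : (Pi.single i 1 : I → ℂ) ∈ W := by rw [h]; trivial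
    simpa [Pi.single_apply] using this x ((hN x).2 hx)

lemma IsInhomogeneous.exists_dual_mod (hB : IsInhomogeneous Λ ι p) (hΛ : HomogeneousData Λ)
    (j : I) : ∃ l : B →ₗ[ℂ] ℂ, (∀ a, l (ι a) = 0) ∧ ∀ i, l (p i) = (1 : Matrix I I ℂ) i j := by
  let q := (LinearMap.range (ι : A →ₐ[ℂ] B).toLinearMap).mkQ
  let L : (I → ℂ) →ₗ[ℂ] B := ∑ i, (LinearMap.proj i).smulRight (p i)
  have hL : ∀ x, L x = ∑ i, x i • p i := fun x => by simp [L]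
  obtain ⟨g, hg⟩ := LinearMap.exists_leftInverse_of_injective (q ∘ₗ L) <| by
    refine LinearMap.ker_eq_bot'.2 fun x hx => hB.linearIndependent_mod hΛ x ?_
    rw [← hL]
    exact (Submodule.Quotient.mk_eq_zero _).1 hx
  refine ⟨LinearMap.proj j ∘ₗ g ∘ₗ q, fun a => ?_, fun i => ?_⟩
  · have : q (ι a) = 0 := (Submodule.Quotient.mk_eq_zero _).2 ⟨a, rfl⟩
    simp [this]
  · have h1 := congrFun (LinearMap.congr_fun hg (Pi.single i 1)) j
    have h2 : L (Pi.single i 1) = p i := by rw [hL]; simp [Pi.single_apply]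
    simp only [LinearMap.comp_apply, h2, LinearMap.id_apply] at h1
    simp only [LinearMap.comp_apply, LinearMap.proj_apply, h1]
    simp [Pi.single_apply, Matrix.one_apply, eq_comm]

lemma actR_add (ρ σ : A →ₗ[ℂ] ℂ) (a : A) : actR (ρ + σ) a = actR ρ a + actR σ a := by
  obtain ⟨n, b, c, h⟩ := exists_comul_eq a
  simp [actR_of_comul _ h, add_smul, Finset.sum_add_distrib]

lemma actR_smul (z : ℂ) (ρ : A →ₗ[ℂ] ℂ) (a : A) : actR (z • ρ) a = z • actR ρ a := by
  obtain ⟨n, b, c, h⟩ := exists_comul_eq a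
  simp [actR_of_comul _ h, smul_smul, Finset.smul_sum]

lemma HomogeneousData.exists_antipode_inv (hΛ : HomogeneousData Λ) :
    ∃ S' : A →ₗ[ℂ] A, ∀ {n : ℕ} {w : Matrix (Fin n) (Fin n) A}, IsRep w → ∀ c d,
      ∑ e, S' (w e d) * w c e = (1 : Matrix (Fin n) (Fin n) ℂ) c d • (1 : A) := by
  let S := LinearEquiv.ofBijective (HopfAlgebra.antipode ℂ (A := A)) hΛ.antipode_bijective
  have hS : ∀ a, HopfAlgebra.antipode ℂ (S.symm a) = a := fun a => S.apply_symm_apply a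
  refine ⟨S.symm.toLinearMap, fun {n w} hw c d => S.injective ?_⟩
  change HopfAlgebra.antipode ℂ _ = HopfAlgebra.antipode ℂ _
  rw [map_sum, map_smul, HopfAlgebra.antipode_one, ← hw.antipode_mul]
  refine Finset.sum_congr rfl fun e _ => ?_
  rw [HopfAlgebra.antipode_mul_antidistrib, LinearEquiv.coe_coe, hS]

/-- `Γ` is a free left `A`-module on `1` and the `p_i`. -/
lemma IsInhomogeneous.free (hB : IsInhomogeneous Λ ι p) (hΛ : HomogeneousData Λ)
    (a : I → A) (ha : ∑ i, ι (a i) * p i ∈ Set.range ι) : a = 0 := by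
  obtain ⟨r, hr⟩ := LinearMap.exists_leftInverse_of_injective (ι : A →ₐ[ℂ] B).toLinearMap
    (LinearMap.ker_eq_bot.2 hB.injective)
  replace hr : ∀ a, r (ι a) = a := fun a => LinearMap.congr_fun hr a
  obtain ⟨S', hS'⟩ := hΛ.exists_antipode_inv
  funext j
  obtain ⟨l, hl, hlp⟩ := hB.exists_dual_mod hΛ j
  let τ : B → A →ₗ[ℂ] ℂ := fun b =>
    l ∘ₗ LinearMap.mulRight ℂ b ∘ₗ (ι : A →ₐ[ℂ] B).toLinearMap ∘ₗ S'
  have hτ : ∀ b c, τ b c = l (ι (S' c) * b) := fun b c => rfl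
  have hτι : ∀ a, τ (ι a) = 0 := fun a => by
    ext c
    rw [hτ, ← map_mul, hl, LinearMap.zero_apply]
  let Θ : B →ₗ[ℂ] B →ₗ[ℂ] A := LinearMap.mk₂ ℂ (fun b b' => actR (τ b) (r b'))
    (fun b c b' => by
      rw [← actR_add]; congr 2; ext; simp [hτ, mul_add])
    (fun z b b' => by
      rw [← actR_smul]; congr 2; ext; simp [hτ])
    (fun b b' c' => by simp) (fun z b b' => by simp)
  have hτι' : ∀ a a', τ (ι a * ι a') = 0 := fun a a' => by rw [← map_mul, hτι]
  have hΘ : ∀ b b', Θ b b' = actR (τ b) (r b') := fun b b' => rfl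
  let Ψ : B →ₗ[ℂ] A := TensorProduct.lift Θ ∘ₗ Coalgebra.comul
  have hΨι : ∀ a, Ψ (ι a) = 0 := fun a => by
    obtain ⟨n, b, c, h⟩ := exists_comul_eq a
    have h' : Coalgebra.comul (R := ℂ) (ι a) = ∑ k, ι (b k) ⊗ₜ[ℂ] ι (c k) := by
      rw [← CoalgHomClass.map_comp_comul_apply, h]
      simp
    have h0 : ∀ x : A, actR (0 : A →ₗ[ℂ] ℂ) x = 0 := fun x => by simp [actR]
    simp [Ψ, h', hΘ, hτι, h0]
  have hΨp : ∀ i, Ψ ∘ₗ LinearMap.mulRight ℂ (p i) ∘ₗ (ι : A →ₐ[ℂ] B).toLinearMap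
      = (1 : Matrix I I ℂ) i j • LinearMap.id := by
    intro i
    refine linearMap_ext_irrep hΛ.completelyReducible fun n w hw c d => ?_
    have h' : Coalgebra.comul (R := ℂ) (ι (w c d)) = ∑ k, ι (w c k) ⊗ₜ[ℂ] ι (w k d) := by
      rw [← CoalgHomClass.map_comp_comul_apply, hw.1.1]
      simp
    have h0 : ∀ x : A, actR (0 : A →ₗ[ℂ] ℂ) x = 0 := fun x => by simp [actR]
    have h1 : Ψ (ι (w c d) * p i) = ∑ k, actR (τ (ι (w c k) * p i)) (w k d) := by
      simp only [Ψ, LinearMap.comp_apply, Bialgebra.comul_mul, h', hB.comul_p, Finset.sum_mul,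
        Finset.mul_sum, mul_add, map_add, map_sum,
        Algebra.TensorProduct.tmul_mul_tmul, TensorProduct.lift.tmul, hΘ,
        Fintype.sum_sum_type, Sum.elim_inl, Sum.elim_inr, hτι', h0, mul_one, hr]
      simp
    have h2 : ∀ f, ∑ k, τ (ι (w c k) * p i) (w k f) = (1 : Matrix (Fin n) (Fin n) ℂ) c f *
        (1 : Matrix I I ℂ) i j := by
      intro f
      simp only [hτ, ← mul_assoc, ← map_mul]
      rw [← map_sum, ← Finset.sum_mul, ← map_sum, hS' hw.1, map_smul, map_one, smul_mul_assoc,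
        one_mul, map_smul, hlp, smul_eq_mul]
    change Ψ (ι (w c d) * p i) = (1 : Matrix I I ℂ) i j • w c d
    simp only [h1, hw.1.actR]
    rw [Finset.sum_comm]
    simp only [← Finset.sum_smul, h2]
    simp [Matrix.one_apply]
  obtain ⟨a', ha'⟩ := ha
  have h3 := hΨι a'
  rw [ha', map_sum] at h3
  have h4 : ∀ i, Ψ (ι (a i) * p i) = (1 : Matrix I I ℂ) i j • a i := fun i =>
    LinearMap.congr_fun (hΨp i) (a i)
  simp only [h4] at h3
  simpa [Matrix.one_apply] using h3

/-- The coordinates of elements of `Γ`. -/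
lemma IsInhomogeneous.exists_coord (hB : IsInhomogeneous Λ ι p) (hΛ : HomogeneousData Λ) :
    ∃ (P : I → B →ₗ[ℂ] A) (P₀ : B →ₗ[ℂ] A),
      (∀ j a i, P j (ι a * p i) = (1 : Matrix I I ℂ) i j • a) ∧
      (∀ j a, P j (ι a) = 0) ∧ (∀ a i, P₀ (ι a * p i) = 0) ∧ (∀ a, P₀ (ι a) = a) := by
  let L : (I → A) × A →ₗ[ℂ] B :=
    (∑ i, LinearMap.mulRight ℂ (p i) ∘ₗ (ι : A →ₐ[ℂ] B).toLinearMap ∘ₗ LinearMap.proj i).coprod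
      (ι : A →ₐ[ℂ] B).toLinearMap
  have hL : ∀ x, L x = ∑ i, ι (x.1 i) * p i + ι x.2 := fun x => by simp [L]
  obtain ⟨g, hg⟩ := LinearMap.exists_leftInverse_of_injective L <| by
    refine LinearMap.ker_eq_bot'.2 fun x hx => ?_
    rw [hL] at hx
    have h1 : x.1 = 0 := hB.free hΛ x.1 ⟨-x.2, by rw [map_neg, eq_neg_of_add_eq_zero_left hx]⟩
    have h2 : x.2 = 0 := hB.injective (by simpa [h1] using hx)
    exact Prod.ext h1 h2
  have hg' : ∀ x, g (L x) = x := fun x => LinearMap.congr_fun hg x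
  have e1 : ∀ a i, ι a * p i = L (Pi.single i a, 0) := fun a i => by
    rw [hL]
    rw [Finset.sum_eq_single i (fun b _ hb => by simp [hb]) (by simp)]
    simp
  have e2 : ∀ a, ι a = L (0, a) := fun a => by rw [hL]; simp
  refine ⟨fun j => LinearMap.proj j ∘ₗ LinearMap.fst ℂ _ _ ∘ₗ g, LinearMap.snd ℂ _ _ ∘ₗ g,
    fun j a i => ?_, fun j a => ?_, fun a i => ?_, fun a => ?_⟩
  · rw [e1]
    simp only [LinearMap.comp_apply, hg', LinearMap.fst_apply, LinearMap.proj_apply]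
    rcases eq_or_ne i j with rfl | h
    · simp
    · simp [h]
  · rw [e2]
    simp [hg']
  · rw [e1]
    simp [hg']
  · rw [e2]
    simp [hg']

end Freeness

section Leading

variable {A B I : Type*} [Ring A] [Ring B] [Fintype I] [DecidableEq I]

lemma mem_Gam_iff {C : Type*} [Ring C] [Bialgebra ℂ A] [Algebra ℂ C] {φ : A →ₐ[ℂ] C} {q : I → C}
    {x : C} : x ∈ Gam φ q ↔ ∃ (a : I → A) (b : A), x = ∑ i, φ (a i) * q i + φ b := by
  constructor
  · intro hx
    obtain ⟨y, hy, z, ⟨b, rfl⟩, rfl⟩ := Submodule.mem_sup.1 hx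
    clear hx
    suffices ∃ a : I → A, y = ∑ i, φ (a i) * q i by
      obtain ⟨a, rfl⟩ := this
      exact ⟨a, b, rfl⟩
    induction hy using Submodule.span_induction with
    | mem y h =>
      obtain ⟨⟨a, i⟩, rfl⟩ := h
      refine ⟨Pi.single i a, ?_⟩
      rw [Finset.sum_eq_single i (fun b _ hb => by simp [hb]) (by simp)]
      simp
    | zero => exact ⟨0, by simp⟩
    | add y y' hy hy' h h' =>
      obtain ⟨a, rfl⟩ := h
      obtain ⟨a', rfl⟩ := h'
      exact ⟨a + a', by simp [add_mul, Finset.sum_add_distrib]⟩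
    | smul c y hy h =>
      obtain ⟨a, rfl⟩ := h
      exact ⟨c • a, by simp [Finset.smul_sum]⟩
  · rintro ⟨a, b, rfl⟩
    refine Submodule.add_mem _ (Submodule.sum_mem _ fun i _ => ?_) ?_
    · exact Submodule.mem_sup_left (Submodule.subset_span ⟨(a i, i), rfl⟩)
    · exact Submodule.mem_sup_right ⟨b, rfl⟩

variable [HopfAlgebra ℂ A] [Bialgebra ℂ B] {Λ : Matrix I I A} {ι : A →ₐc[ℂ] B} {p : I → B}

lemma IsInhomogeneous.coeff_ext (hB : IsInhomogeneous Λ ι p) (hΛ : HomogeneousData Λ)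
    {a a' : I → A} {b b' : A} (h : ∑ i, ι (a i) * p i + ι b = ∑ i, ι (a' i) * p i + ι b') :
    a = a' ∧ b = b' := by
  have h1 : ∑ i, ι ((a - a') i) * p i = ι (b' - b) := by
    simp only [Pi.sub_apply, map_sub, sub_mul, Finset.sum_sub_distrib]
    rw [sub_eq_sub_iff_add_eq_add, h, add_comm]
  have h2 := hB.free hΛ (a - a') ⟨_, h1.symm⟩
  refine ⟨sub_eq_zero.1 h2, ?_⟩
  rw [h2] at h1
  have : ι (b' - b) = ι 0 := by rw [← h1]; simp
  exact (sub_eq_zero.1 (hB.injective this)).symm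

/-- Comparison of coefficients after applying `ρ * ·` to `p_s a = F_st(a) p_t + h_s(a)`. -/
lemma IsInhomogeneous.slice_cross (hB : IsInhomogeneous Λ ι p) (hΛ : HomogeneousData Λ)
    {F : I → I → A →ₗ[ℂ] A} {h : I → A →ₗ[ℂ] A}
    (hF : ∀ s a, p s * ι a = ∑ t, ι (F s t a) * p t + ι (h s a)) (ρ : B →ₗ[ℂ] ℂ) (s : I) (a : A) :
    (∀ t, F s t (actL (ρ ∘ₗ (ι : A →ₐ[ℂ] B).toLinearMap) a) =
      actL (ρ ∘ₗ (ι : A →ₐ[ℂ] B).toLinearMap) (F s t a)) ∧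
    ∑ u, Λ s u * actL ((ρ ∘ₗ LinearMap.mulLeft ℂ (p u)) ∘ₗ (ι : A →ₐ[ℂ] B).toLinearMap) a +
        h s (actL (ρ ∘ₗ (ι : A →ₐ[ℂ] B).toLinearMap) a) =
      ∑ t, ∑ u, actL ((ρ ∘ₗ LinearMap.mulRight ℂ (p u)) ∘ₗ (ι : A →ₐ[ℂ] B).toLinearMap) (F s t a)
        * Λ t u + actL (ρ ∘ₗ (ι : A →ₐ[ℂ] B).toLinearMap) (h s a) := by
  have h1 := congrArg (actL ρ) (hF s a)
  rw [hB.actL_p_mul] at h1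
  simp only [map_add, map_sum, hB.actL_mul_p, actL_map, hF, Finset.sum_add_distrib] at h1
  have h2 := hB.coeff_ext hΛ
    (a := fun t => F s t (actL (ρ ∘ₗ (ι : A →ₐ[ℂ] B).toLinearMap) a))
    (a' := fun t => actL (ρ ∘ₗ (ι : A →ₐ[ℂ] B).toLinearMap) (F s t a))
    (b := ∑ u, Λ s u * actL ((ρ ∘ₗ LinearMap.mulLeft ℂ (p u)) ∘ₗ (ι : A →ₐ[ℂ] B).toLinearMap) a +
        h s (actL (ρ ∘ₗ (ι : A →ₐ[ℂ] B).toLinearMap) a))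
    (b' := ∑ t, ∑ u, actL ((ρ ∘ₗ LinearMap.mulRight ℂ (p u)) ∘ₗ (ι : A →ₐ[ℂ] B).toLinearMap)
      (F s t a) * Λ t u + actL (ρ ∘ₗ (ι : A →ₐ[ℂ] B).toLinearMap) (h s a)) (by
      simp only [map_add, map_sum, map_mul]
      rw [add_left_comm, h1]
      abel)
  exact ⟨fun t => congrFun h2.1 t, h2.2⟩

lemma IsInhomogeneous.exists_isLeading (hB : IsInhomogeneous Λ ι p) (hΛ : HomogeneousData Λ) :
    ∃ f, IsLeading (ι : A →ₐ[ℂ] B) p f := by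
  obtain ⟨P, P₀, hP, hPι, hP₀, hP₀ι⟩ := hB.exists_coord hΛ
  let F : I → I → A →ₗ[ℂ] A := fun s t =>
    P t ∘ₗ LinearMap.mulLeft ℂ (p s) ∘ₗ (ι : A →ₐ[ℂ] B).toLinearMap
  let h : I → A →ₗ[ℂ] A := fun s =>
    P₀ ∘ₗ LinearMap.mulLeft ℂ (p s) ∘ₗ (ι : A →ₐ[ℂ] B).toLinearMap
  have hF : ∀ s a, p s * ι a = ∑ t, ι (F s t a) * p t + ι (h s a) := by
    intro s a
    have hp : p s ∈ Gam (ι : A →ₐ[ℂ] B) p :=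
      Submodule.mem_sup_left (Submodule.subset_span ⟨(1, s), by simp⟩)
    obtain ⟨c, d, hcd⟩ := mem_Gam_iff.1 (hB.mul_mem _ hp a)
    have hcd : p s * ι a = ∑ t, ι (c t) * p t + ι d := hcd
    have h1 : ∀ t, F s t a = c t := fun t => by
      change P t (p s * ι a) = _
      simp [hcd, hP, hPι, Matrix.one_apply]
    have h2 : h s a = d := by
      change P₀ (p s * ι a) = _
      simp [hcd, hP₀, hP₀ι]
    simp only [h1, h2, hcd]
  refine ⟨fun s t => Coalgebra.counit ∘ₗ F s t, fun s a => ⟨h s a, ?_⟩⟩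
  have h3 : ∀ t, actR (Coalgebra.counit ∘ₗ F s t) a = F s t a := fun t => by
    refine eq_of_forall_dual fun σ => ?_
    obtain ⟨ρ, hρ⟩ := exists_extend_dual hB.injective σ
    have hρ' : ρ ∘ₗ (ι : A →ₐ[ℂ] B).toLinearMap = σ := LinearMap.ext hρ
    have := (hB.slice_cross hΛ hF ρ s a).1 t
    rw [hρ'] at this
    rw [← dual_actL, LinearMap.comp_apply, this, counit_actL]
  simp only [h3]
  exact (sub_eq_of_eq_add' (hF s a)).symm

lemma IsInhomogeneous.isLeading_unique (hB : IsInhomogeneous Λ ι p) (hΛ : HomogeneousData Λ)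
    {f f' : I → I → A →ₗ[ℂ] ℂ} (hf : IsLeading (ι : A →ₐ[ℂ] B) p f)
    (hf' : IsLeading (ι : A →ₐ[ℂ] B) p f') : f = f' := by
  funext s t
  ext a
  obtain ⟨b, hb⟩ := hf s a
  obtain ⟨b', hb'⟩ := hf' s a
  have := (hB.coeff_ext hΛ (a := fun t => actR (f s t) a) (a' := fun t => actR (f' s t) a)
    (b := b) (b' := b') ((add_eq_of_eq_sub' hb).trans (add_eq_of_eq_sub' hb').symm)).1
  rw [← counit_actR, congrFun this t, counit_actR]

lemma IsInhomogeneous.exists_remainder (hB : IsInhomogeneous Λ ι p) (hΛ : HomogeneousData Λ)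
    {f : I → I → A →ₗ[ℂ] ℂ} (hf : IsLeading (ι : A →ₐ[ℂ] B) p f) :
    ∃ h : I → A →ₗ[ℂ] A, ∀ s a, p s * ι a = ∑ t, ι (actR (f s t) a) * p t + ι (h s a) := by
  obtain ⟨P, P₀, hP, hPι, hP₀, hP₀ι⟩ := hB.exists_coord hΛ
  refine ⟨fun s => P₀ ∘ₗ LinearMap.mulLeft ℂ (p s) ∘ₗ (ι : A →ₐ[ℂ] B).toLinearMap, fun s a => ?_⟩
  obtain ⟨b, hb⟩ := hf s a
  have hb : p s * ι a = ∑ t, ι (actR (f s t) a) * p t + ι b := (add_eq_of_eq_sub' hb).symm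
  have h2 : P₀ (p s * ι a) = b := by simp [hb, hP₀, hP₀ι]
  change _ = _ + ι (P₀ (p s * ι a))
  rw [h2, hb]

variable {f : I → I → A →ₗ[ℂ] ℂ} {h : I → A →ₗ[ℂ] A}

lemma IsInhomogeneous.actR_mul (hB : IsInhomogeneous Λ ι p) (hΛ : HomogeneousData Λ)
    (hf : ∀ s a, p s * ι a = ∑ t, ι (actR (f s t) a) * p t + ι (h s a)) (s : I) (a b : A) :
    (∀ u, actR (f s u) (a * b) = ∑ t, actR (f s t) a * actR (f t u) b) ∧
      h s (a * b) = ∑ t, actR (f s t) a * h t b + h s a * b := by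
  have h1 : p s * ι (a * b) = (p s * ι a) * ι b := by rw [map_mul, mul_assoc]
  rw [hf, hf, add_mul, Finset.sum_mul] at h1
  simp only [mul_assoc, hf, mul_add, Finset.sum_add_distrib, Finset.mul_sum] at h1
  have := hB.coeff_ext hΛ (a := fun u => actR (f s u) (a * b))
    (a' := fun u => ∑ t, actR (f s t) a * actR (f t u) b) (b := h s (a * b))
    (b' := ∑ t, actR (f s t) a * h t b + h s a * b) (by
      rw [h1]
      simp only [map_add, map_sum, map_mul, Finset.sum_mul, mul_assoc, ← add_assoc]
      rw [Finset.sum_comm])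
  exact ⟨fun u => congrFun this.1 u, this.2⟩

lemma IsInhomogeneous.leading_mul (hB : IsInhomogeneous Λ ι p) (hΛ : HomogeneousData Λ)
    (hf : ∀ s a, p s * ι a = ∑ t, ι (actR (f s t) a) * p t + ι (h s a)) (s u : I) (a b : A) :
    f s u (a * b) = ∑ t, f s t a * f t u b := by
  have := congrArg (Coalgebra.counit (R := ℂ)) ((hB.actR_mul hΛ hf s a b).1 u)
  simpa [Bialgebra.counit_mul] using this

lemma IsInhomogeneous.leading_one (hB : IsInhomogeneous Λ ι p) (hΛ : HomogeneousData Λ)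
    (hf : ∀ s a, p s * ι a = ∑ t, ι (actR (f s t) a) * p t + ι (h s a)) (s t : I) :
    f s t 1 = (1 : Matrix I I ℂ) s t := by
  have h1 := hf s 1
  have := (hB.coeff_ext hΛ (a' := fun t => actR (f s t) 1)
    (a := fun t => (1 : Matrix I I ℂ) s t • (1 : A)) (b := 0) (b' := h s 1) (by
      rw [← h1]
      simp [Matrix.one_apply])).1
  rw [← counit_actR, ← congrFun this t]
  simp

/-- `Λ_st (f_tr * a) = (a * f_st) Λ_tr`. -/
lemma IsInhomogeneous.leading_intertwine (hB : IsInhomogeneous Λ ι p) (hΛ : HomogeneousData Λ)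
    (hf : ∀ s a, p s * ι a = ∑ t, ι (actR (f s t) a) * p t + ι (h s a)) (s r : I) (a : A) :
    ∑ t, Λ s t * actL (f t r) a = ∑ t, actR (f s t) a * Λ t r := by
  obtain ⟨P, P₀, hP, hPι, hP₀, hP₀ι⟩ := hB.exists_coord hΛ
  have key := (hB.slice_cross hΛ hf (Coalgebra.counit ∘ₗ P r) s a).2
  have e0 : (Coalgebra.counit ∘ₗ P r) ∘ₗ (ι : A →ₐ[ℂ] B).toLinearMap = 0 := by
    ext a; simp [hPι]
  have e1 : ∀ u, ((Coalgebra.counit ∘ₗ P r) ∘ₗ LinearMap.mulLeft ℂ (p u)) ∘ₗ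
      (ι : A →ₐ[ℂ] B).toLinearMap = f u r := by
    intro u
    ext a
    have := hf u a
    simp [this, hP, hPι, Matrix.one_apply]
  have e2 : ∀ u, ((Coalgebra.counit ∘ₗ P r) ∘ₗ LinearMap.mulRight ℂ (p u)) ∘ₗ
      (ι : A →ₐ[ℂ] B).toLinearMap = (1 : Matrix I I ℂ) u r • Coalgebra.counit := by
    intro u
    ext a
    simp [hP]
  have h0 : ∀ x : A, actL (0 : A →ₗ[ℂ] ℂ) x = 0 := fun x => by simp [actL]
  have h1 : ∀ u (x : A), actL ((1 : Matrix I I ℂ) u r • (Coalgebra.counit : A →ₗ[ℂ] ℂ)) x =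
      (1 : Matrix I I ℂ) u r • x := fun u x => by
    rw [Matrix.one_apply]
    split_ifs <;> simp [h0]
  simp only [e0, e1, e2, h0, h1, map_zero, add_zero] at key
  rw [key]
  simp [Matrix.one_apply]

lemma IsInhomogeneous.slice_remainder (hB : IsInhomogeneous Λ ι p) (hΛ : HomogeneousData Λ)
    (hf : ∀ s a, p s * ι a = ∑ t, ι (actR (f s t) a) * p t + ι (h s a)) (ρ : A →ₗ[ℂ] ℂ)
    (s : I) (a : A) :
    actL ρ (h s a) = ∑ u, Λ s u * actL (ρ ∘ₗ h u) a + h s (actL ρ a) := by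
  obtain ⟨P, P₀, hP, hPι, hP₀, hP₀ι⟩ := hB.exists_coord hΛ
  have key := (hB.slice_cross hΛ hf (ρ ∘ₗ P₀) s a).2
  have e0 : (ρ ∘ₗ P₀) ∘ₗ (ι : A →ₐ[ℂ] B).toLinearMap = ρ := by
    ext a; simp [hP₀ι]
  have e1 : ∀ u, ((ρ ∘ₗ P₀) ∘ₗ LinearMap.mulLeft ℂ (p u)) ∘ₗ
      (ι : A →ₐ[ℂ] B).toLinearMap = ρ ∘ₗ h u := by
    intro u
    ext a
    have := hf u a
    simp [this, hP₀, hP₀ι]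
  have e2 : ∀ u, ((ρ ∘ₗ P₀) ∘ₗ LinearMap.mulRight ℂ (p u)) ∘ₗ
      (ι : A →ₐ[ℂ] B).toLinearMap = 0 := by
    intro u
    ext a
    simp [hP₀]
  have h0 : ∀ x : A, actL (0 : A →ₗ[ℂ] ℂ) x = 0 := fun x => by simp [actL]
  simp only [e0, e1, e2, h0, zero_mul, Finset.sum_const_zero, zero_add] at key
  exact key.symm

end Leading

section Cocycle

variable {A B I : Type*} [Ring A] [Ring B] [Fintype I] [DecidableEq I]

lemma isRep_kronecker [Bialgebra ℂ A] {m n : Type*} [Fintype m] [DecidableEq m] [Fintype n]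
    [DecidableEq n] {v : Matrix m m A} {w : Matrix n n A} (hv : IsRep v) (hw : IsRep w) :
    IsRep (v ⊗ₖ w) := by
  refine ⟨fun i j => ?_, fun i j => ?_⟩
  · simp only [Matrix.kroneckerMap_apply, Bialgebra.comul_mul, hv.1, hw.1, Finset.sum_mul_sum,
      Algebra.TensorProduct.tmul_mul_tmul, Fintype.sum_prod_type]
  · simp only [Matrix.kroneckerMap_apply, Bialgebra.counit_mul, hv.2, hw.2]
    rw [← Matrix.one_kronecker_one, Matrix.kroneckerMap_apply]

variable [HopfAlgebra ℂ A] [Bialgebra ℂ B] {Λ : Matrix I I A} {ι : A →ₐc[ℂ] B} {p : I → B}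
  {f : I → I → A →ₗ[ℂ] ℂ} {h : I → A →ₗ[ℂ] A}

/-- The remainder `h` is a coboundary, by averaging against the Haar functional. -/
lemma IsInhomogeneous.exists_coboundary (hB : IsInhomogeneous Λ ι p) (hΛ : HomogeneousData Λ)
    (hf : ∀ s a, p s * ι a = ∑ t, ι (actR (f s t) a) * p t + ι (h s a)) :
    ∃ η : I → A →ₗ[ℂ] ℂ, ∀ s a, h s a = actR (η s) a - ∑ t, Λ s t * actL (η t) a := by
  obtain ⟨χ, hχ1, hχ⟩ := exists_haar hΛ.completelyReducible
  let η : I → A →ₗ[ℂ] ℂ := fun s => χ ∘ₗ LinearMap.mul' ℂ A ∘ₗ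
    TensorProduct.map (h s) (HopfAlgebra.antipode ℂ) ∘ₗ Coalgebra.comul
  refine ⟨η, fun s => ?_⟩
  suffices h s = actR (η s) - ∑ t, LinearMap.mulLeft ℂ (Λ s t) ∘ₗ actL (η t) by
    intro a
    conv_lhs => rw [this]
    simp
  refine linearMap_ext_irrep hΛ.completelyReducible fun n w hw c d => ?_
  have hw := hw.1
  have hη : ∀ s c d, η s (w c d) = ∑ e, χ (h s (w c e) * HopfAlgebra.antipode ℂ (w e d)) := by
    intro s c d
    simp [η, hw.1]
  have key : ∀ c d, η s (w c d) • (1 : A) =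
      ∑ g, (∑ u, ∑ k, η u (w k g) • (Λ s u * w c k)) * HopfAlgebra.antipode ℂ (w g d) +
        ∑ e, h s (w c e) * HopfAlgebra.antipode ℂ (w e d) := by
    intro c d
    have e1 : ∀ e, actL χ (h s (w c e) * HopfAlgebra.antipode ℂ (w e d)) =
        ∑ g, (∑ u, ∑ k, χ (h u (w k e) * HopfAlgebra.antipode ℂ (w e g)) • (Λ s u * w c k) +
          ∑ k, χ (w k e * HopfAlgebra.antipode ℂ (w e g)) • h s (w c k)) *
            HopfAlgebra.antipode ℂ (w g d) := by
      intro e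
      rw [actL_mul_right χ _ (hw.comul_antipode e d)]
      refine Finset.sum_congr rfl fun g _ => ?_
      rw [hB.slice_remainder hΛ hf]
      simp only [hw.actL, map_sum, map_smul, Finset.mul_sum, mul_smul_comm, LinearMap.comp_apply,
        LinearMap.mulRight_apply]
    have e2 : ∀ k g, ∑ e, χ (w k e * HopfAlgebra.antipode ℂ (w e g)) =
        (1 : Matrix (Fin n) (Fin n) ℂ) k g := fun k g => by
      rw [← map_sum, hw.mul_antipode, map_smul, hχ1, smul_eq_mul, mul_one]
    rw [hη, ← map_sum, ← hχ, map_sum]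
    simp only [e1]
    rw [Finset.sum_comm]
    simp only [← Finset.sum_mul, Finset.sum_add_distrib, add_mul]
    congr 1
    · refine Finset.sum_congr rfl fun g _ => ?_
      congr 1
      rw [Finset.sum_comm]
      refine Finset.sum_congr rfl fun u _ => ?_
      rw [Finset.sum_comm]
      simp only [← Finset.sum_smul, hη]
    · refine Finset.sum_congr rfl fun g _ => ?_
      congr 1
      rw [Finset.sum_comm]
      simp only [← Finset.sum_smul, e2]
      simp [Matrix.one_apply]
  have e3 : ∑ k, η s (w c k) • w k d = ∑ k, (η s (w c k) • (1 : A)) * w k d := by simp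
  simp only [LinearMap.sub_apply, LinearMap.sum_apply, LinearMap.comp_apply, hw.actR, hw.actL,
    LinearMap.mulLeft_apply, e3, key, add_mul, Finset.sum_add_distrib, Finset.sum_mul, mul_assoc]
  have e4 : ∀ g, ∑ k, HopfAlgebra.antipode ℂ (w g k) * w k d =
    (1 : Matrix (Fin n) (Fin n) ℂ) g d • (1 : A) := fun g => hw.antipode_mul g d
  rw [eq_sub_iff_add_eq, add_comm]
  congr 1
  · rw [Finset.sum_comm]
    simp only [smul_mul_assoc, mul_assoc]
    have e5 : ∀ g, ∑ k, ∑ u, ∑ l, η u (w l g) • (Λ s u * (w c l *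
        (HopfAlgebra.antipode ℂ (w g k) * w k d))) =
        ∑ u, ∑ l, η u (w l g) • (Λ s u * (w c l *
          ((1 : Matrix (Fin n) (Fin n) ℂ) g d • (1 : A)))) := by
      intro g
      rw [Finset.sum_comm]
      refine Finset.sum_congr rfl fun u _ => ?_
      rw [Finset.sum_comm]
      refine Finset.sum_congr rfl fun l _ => ?_
      rw [← Finset.smul_sum, ← Finset.mul_sum, ← Finset.mul_sum, e4]
    simp only [e5]
    rw [Finset.sum_comm]
    refine Finset.sum_congr rfl fun u _ => ?_
    rw [Finset.sum_comm, Finset.mul_sum]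
    refine Finset.sum_congr rfl fun l _ => ?_
    simp [Matrix.one_apply]
  · rw [Finset.sum_comm]
    simp only [← Finset.mul_sum, e4]
    simp [Matrix.one_apply]

/-- Multiplicativity of `η`, from `Mor(v ⊗ w, Λ ⊗ v ⊗ w) = 0`. -/
lemma IsInhomogeneous.coboundary_mul (hB : IsInhomogeneous Λ ι p) (hΛ : HomogeneousData Λ)
    (hf : ∀ s a, p s * ι a = ∑ t, ι (actR (f s t) a) * p t + ι (h s a)) {η : I → A →ₗ[ℂ] ℂ}
    (hη : ∀ s a, h s a = actR (η s) a - ∑ t, Λ s t * actL (η t) a) (s : I) (a b : A) :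
    η s (a * b) = ∑ t, f s t a * η t b + η s a * Coalgebra.counit (R := ℂ) b := by
  suffices H : (LinearMap.mul ℂ A).compr₂ (η s) = ∑ t, (f s t).smulRight (η t) +
      (η s).smulRight Coalgebra.counit by
    have := LinearMap.congr_fun (LinearMap.congr_fun H a) b
    simpa using this
  refine linearMap_ext_irrep hΛ.completelyReducible fun m v hv c d => ?_
  refine linearMap_ext_irrep hΛ.completelyReducible fun n w hw c' d' => ?_
  have hvw := isRep_kronecker hv.1 hw.1
  have := hΛ.intertwiner_tensor_eq_zero hv hw (fun i z y => η i ((v ⊗ₖ w) z y) -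
    ∑ t, f i t (v z.1 y.1) * η t (w z.2 y.2) -
      η i (v z.1 y.1) * (1 : Matrix (Fin n) (Fin n) ℂ) z.2 y.2) (fun i z y => by
    set a := v z.1 y.1 with ha
    set b := w z.2 y.2 with hb
    have e1 : ∀ i, ∑ x, η i ((v ⊗ₖ w) z x) • (v x.1 y.1 * w x.2 y.2) = actR (η i) (a * b) :=
      fun i => (hvw.actR (η i) z y).symm
    have e2 : ∀ t, ∑ x, η t ((v ⊗ₖ w) x y) • (v z.1 x.1 * w z.2 x.2) = actL (η t) (a * b) :=
      fun t => (hvw.actL (η t) z y).symm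
    have e3 : ∀ (g g' : A →ₗ[ℂ] ℂ), ∑ x : Fin m × Fin n, (g (v z.1 x.1) * g' (w z.2 x.2)) •
        (v x.1 y.1 * w x.2 y.2) = actR g a * actR g' b := by
      intro g g'
      rw [hv.1.actR, hw.1.actR, Finset.sum_mul_sum, Fintype.sum_prod_type]
      simp [smul_smul, mul_comm]
    have e4 : ∀ (g g' : A →ₗ[ℂ] ℂ), ∑ x : Fin m × Fin n, (g (v x.1 y.1) * g' (w x.2 y.2)) •
        (v z.1 x.1 * w z.2 x.2) = actL g a * actL g' b := by
      intro g g'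
      rw [hv.1.actL, hw.1.actL, Finset.sum_mul_sum, Fintype.sum_prod_type]
      simp [smul_smul, mul_comm]
    have hm := (hB.actR_mul hΛ hf i a b).2
    rw [hη, hη] at hm
    simp only [hη, mul_sub, Finset.sum_sub_distrib, Finset.mul_sum] at hm
    have e5 : ∑ t, ∑ u, actR (f i t) a * (Λ t u * actL (η u) b) =
        ∑ t, ∑ u, Λ i t * (actL (f t u) a * actL (η u) b) := by
      rw [Finset.sum_comm]
      conv_rhs => rw [Finset.sum_comm]
      refine Finset.sum_congr rfl fun u _ => ?_
      simp only [← mul_assoc]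
      rw [← Finset.sum_mul, ← Finset.sum_mul, hB.leading_intertwine hΛ hf]
    rw [e5, sub_mul, Finset.sum_mul] at hm
    have e6 : ∀ i, ∑ x : Fin m × Fin n, (η i ((v ⊗ₖ w) z x) -
        ∑ t, f i t (v z.1 x.1) * η t (w z.2 x.2) -
          η i (v z.1 x.1) * (1 : Matrix (Fin n) (Fin n) ℂ) z.2 x.2) • (v x.1 y.1 * w x.2 y.2) =
        actR (η i) (a * b) - ∑ t, actR (f i t) a * actR (η t) b - actR (η i) a * b := by
      intro i
      simp only [sub_smul, Finset.sum_smul, Finset.sum_sub_distrib, e1, ← hw.1.2, e3, actR_counit]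
      rw [Finset.sum_comm]
      simp only [e3]
    have e7 : ∀ t, ∑ x : Fin m × Fin n, (η t ((v ⊗ₖ w) x y) -
        ∑ u, f t u (v x.1 y.1) * η u (w x.2 y.2) -
          η t (v x.1 y.1) * (1 : Matrix (Fin n) (Fin n) ℂ) x.2 y.2) •
            (Λ i t * (v z.1 x.1 * w z.2 x.2)) =
        Λ i t * (actL (η t) (a * b) - ∑ u, actL (f t u) a * actL (η u) b - actL (η t) a * b) := by
      intro t
      simp_rw [← mul_smul_comm (_ : ℂ) (Λ i t)]
      rw [← Finset.mul_sum]
      congr 1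
      simp only [sub_smul, Finset.sum_smul, Finset.sum_sub_distrib, e2, ← hw.1.2, e4, actL_counit]
      rw [Finset.sum_comm]
      simp only [e4]
    simp only [e6, e7, mul_sub, Finset.sum_sub_distrib, Finset.mul_sum]
    simp only [← mul_assoc] at hm ⊢
    rw [sub_eq_iff_eq_add] at hm
    rw [hm]
    abel) s (c, c') (d, d')
  simp only [Matrix.kroneckerMap_apply] at this
  rw [sub_sub, sub_eq_zero] at this
  simp [this, hw.1.2]

lemma IsInhomogeneous.isStructureData (hB : IsInhomogeneous Λ ι p) (hΛ : HomogeneousData Λ)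
    (hf : ∀ s a, p s * ι a = ∑ t, ι (actR (f s t) a) * p t + ι (h s a)) {η : I → A →ₗ[ℂ] ℂ}
    (hη : ∀ s a, h s a = actR (η s) a - ∑ t, Λ s t * actL (η t) a) : IsStructureData Λ f η := by
  refine ⟨fun s r a => hB.leading_intertwine hΛ hf s r a, ?_⟩
  have hmul := hB.coboundary_mul hΛ hf hη
  have hη1 : ∀ s, η s 1 = 0 := fun s => by
    have := hmul s 1 1
    simpa [hB.leading_one hΛ hf, Matrix.one_apply] using this
  let L : A →ₗ[ℂ] Matrix (I ⊕ Unit) (I ⊕ Unit) ℂ :=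
    { toFun := fun a => Matrix.fromBlocks (Matrix.of fun i j => f i j a)
        (Matrix.of fun i _ => η i a) 0 (Matrix.of fun _ _ => Coalgebra.counit (R := ℂ) a)
      map_add' := fun a b => by
        rw [Matrix.fromBlocks_add]; congr 1 <;> ext <;> simp
      map_smul' := fun c a => by
        rw [RingHom.id_apply, Matrix.fromBlocks_smul]; congr 1 <;> ext <;> simp }
  refine ⟨AlgHom.ofLinearMap L ?_ ?_, fun a => rfl⟩
  · change Matrix.fromBlocks _ _ _ _ = _
    rw [← Matrix.fromBlocks_one]
    congr 1
    · ext i j; simp [hB.leading_one hΛ hf]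
    · ext i j; simp [hη1]
    · ext i j; simp
  · intro a b
    change Matrix.fromBlocks _ _ _ _ = Matrix.fromBlocks _ _ _ _ * Matrix.fromBlocks _ _ _ _
    rw [Matrix.fromBlocks_multiply]
    congr 1
    · ext i j; simp [hB.leading_mul hΛ hf, Matrix.mul_apply]
    · ext i j; simp [hmul, Matrix.mul_apply]
    · ext i j; simp
    · ext i j; simp [Bialgebra.counit_mul, Matrix.mul_apply]

end Cocycle

section ScalarMatrices

variable {C m n k : Type*} [Ring C] [Algebra ℂ C] [Fintype n] [Fintype k]

/-- A complex matrix acting on a vector with entries in an algebra. -/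
def cmul (M : Matrix m n ℂ) (X : n → C) : m → C := fun i => ∑ x, M i x • X x

lemma cmul_cmul (M : Matrix m n ℂ) (N : Matrix n k ℂ) (X : k → C) :
    cmul M (cmul N X) = cmul (M * N) X := by
  funext i
  simp only [cmul, Matrix.mul_apply, Finset.smul_sum, smul_smul, Finset.sum_smul]
  exact Finset.sum_comm

lemma cmul_add (M : Matrix m n ℂ) (X Y : n → C) : cmul M (X + Y) = cmul M X + cmul M Y := by
  funext i
  simp [cmul, Finset.sum_add_distrib]

lemma cmul_sub (M : Matrix m n ℂ) (X Y : n → C) : cmul M (X - Y) = cmul M X - cmul M Y := by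
  funext i
  simp [cmul, smul_sub, Finset.sum_sub_distrib]

lemma add_cmul (M N : Matrix m n ℂ) (X : n → C) : cmul (M + N) X = cmul M X + cmul N X := by
  funext i
  simp [cmul, add_smul, Finset.sum_add_distrib]

lemma sub_cmul (M N : Matrix m n ℂ) (X : n → C) : cmul (M - N) X = cmul M X - cmul N X := by
  funext i
  simp [cmul, sub_smul, Finset.sum_sub_distrib]

lemma one_cmul [DecidableEq n] (X : n → C) : cmul (1 : Matrix n n ℂ) X = X := by
  funext i
  simp [cmul, Matrix.one_apply]

lemma zero_cmul (X : n → C) : cmul (0 : Matrix m n ℂ) X = 0 := by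
  funext i
  simp [cmul]

end ScalarMatrices

section Quadratic

variable {A B C I : Type*} [Ring A] [Ring B] [Ring C] [Algebra ℂ C] [Fintype I] [DecidableEq I]

section Bialg

variable [Bialgebra ℂ A] {Λ : Matrix I I A} {f : I → I → A →ₗ[ℂ] ℂ} {η : I → A →ₗ[ℂ] ℂ}

/-- The intertwining identity for `a = Λ_lb`, i.e. `R (Λ ⊗ Λ) = (Λ ⊗ Λ) R`. -/
lemma rmat_intertwine (hΛ : IsRep Λ)
    (hint : ∀ s r a, ∑ t, Λ s t * actL (f t r) a = ∑ t, actR (f s t) a * Λ t r) (k b : I × I) :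
    ∑ x, Rmat f Λ k x • (Λ x.1 b.1 * Λ x.2 b.2) = ∑ x, Rmat f Λ x b • (Λ k.1 x.1 * Λ k.2 x.2) := by
  have := hint k.1 b.2 (Λ k.2 b.1)
  simp only [hΛ.actL, hΛ.actR, Finset.mul_sum, Finset.sum_mul, mul_smul_comm,
    smul_mul_assoc] at this
  rw [Fintype.sum_prod_type_right, Fintype.sum_prod_type]
  exact this.symm

lemma CrossRel.mul_rep {φ : A →ₐ[ℂ] C} {q : I → C} (h : CrossRel φ q Λ f η) (hΛ : IsRep Λ)
    (i j b : I) : q i * φ (Λ j b) =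
      ∑ x : I × I, Rmat f Λ (i, j) x • (φ (Λ x.1 b) * q x.2) + ∑ s, η i (Λ j s) • φ (Λ s b) -
        ∑ x : I × I, η x.1 (Λ x.2 b) • φ (Λ i x.1 * Λ j x.2) := by
  rw [h, hΛ.actR]
  simp only [hΛ.actL, hΛ.actR, Finset.mul_sum, Finset.sum_mul, mul_smul_comm,
    smul_mul_assoc, map_sum, map_smul, Fintype.sum_prod_type]
  rw [Finset.sum_comm]
  rfl

/-- The noncommutative polynomials `q_i q_j - η_i(Λ_js) q_s`. -/
def quadElem (q : I → C) (Λ : Matrix I I A) (η : I → A →ₗ[ℂ] ℂ) (x : I × I) : C :=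
  q x.1 * q x.2 - ∑ s, η x.1 (Λ x.2 s) • q s

/-- The vector `(Λ ⊗ Λ) T`. -/
def twist (Λ : Matrix I I A) (T : I × I → ℂ) (x : I × I) : A :=
  ∑ y : I × I, T y • (Λ x.1 y.1 * Λ x.2 y.2)

lemma quadRel_iff {φ : A →ₐ[ℂ] C} {q : I → C} {T : I × I → ℂ} : QuadRel φ q Λ f η T ↔
    cmul (Rmat f Λ - 1) (quadElem q Λ η) + cmul (Rmat f Λ - 1) (fun x => algebraMap ℂ C (T x)) -
      cmul (Rmat f Λ - 1) (fun x => φ (twist Λ T x)) = 0 := by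
  rw [← cmul_add, ← cmul_sub, funext_iff, Prod.forall]
  refine forall_congr' fun k => forall_congr' fun l => ?_
  simp only [cmul, Fintype.sum_prod_type, Pi.sub_apply, Pi.add_apply, quadElem, twist, map_sum,
    map_smul, Pi.zero_apply]

lemma cmul_twist (hΛ : IsRep Λ)
    (hint : ∀ s r a, ∑ t, Λ s t * actL (f t r) a = ∑ t, actR (f s t) a * Λ t r)
    (T : I × I → ℂ) : cmul (Rmat f Λ) (twist Λ T) = twist Λ ((Rmat f Λ).mulVec T) := by
  funext k
  simp only [cmul, twist, Finset.smul_sum, Matrix.mulVec, dotProduct, Finset.sum_smul]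
  rw [Finset.sum_comm]
  conv_rhs => rw [Finset.sum_comm]
  refine Finset.sum_congr rfl fun b _ => ?_
  have := congrArg (T b • ·) (rmat_intertwine hΛ hint k b)
  simp only [Finset.smul_sum] at this
  simpa only [smul_smul, mul_comm (T b)] using this

lemma cmul_sub_one_twist (hΛ : IsRep Λ)
    (hint : ∀ s r a, ∑ t, Λ s t * actL (f t r) a = ∑ t, actR (f s t) a * Λ t r)
    (T : I × I → ℂ) :
    cmul (Rmat f Λ - 1) (twist Λ T) = twist Λ ((Rmat f Λ - 1).mulVec T) := by
  rw [sub_cmul, cmul_twist hΛ hint, one_cmul, Matrix.sub_mulVec, Matrix.one_mulVec]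
  funext x
  simp [twist, sub_smul, Finset.sum_sub_distrib]

end Bialg

variable [HopfAlgebra ℂ A] [Bialgebra ℂ B] {Λ : Matrix I I A} {ι : A →ₐc[ℂ] B} {p : I → B}
  {f : I → I → A →ₗ[ℂ] ℂ} {η : I → A →ₗ[ℂ] ℂ}

lemma IsInhomogeneous.actL_quadElem (hB : IsInhomogeneous Λ ι p) (hΛ : HomogeneousData Λ)
    (hc : CrossRel (ι : A →ₐ[ℂ] B) p Λ f η) (ρ : B →ₗ[ℂ] ℂ) :
    (fun x => actL ρ (quadElem p Λ η x)) =
      (fun x => ι (twist Λ (fun y => ρ (quadElem p Λ η y)) x)) +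
      (fun x => ρ 1 • quadElem p Λ η x) +
      ∑ a, ρ (p a) • cmul (Rmat f Λ + 1) (fun x : I × I => ι (Λ x.1 a) * p x.2) := by
  funext x
  obtain ⟨i, j⟩ := x
  have hmr : ∀ b, p i * ι (Λ j b) =
      ∑ x : I × I, Rmat f Λ (i, j) x • (ι (Λ x.1 b) * p x.2) + ∑ s, η i (Λ j s) • ι (Λ s b) -
        ∑ x : I × I, η x.1 (Λ x.2 b) • ι (Λ i x.1 * Λ j x.2) := hc.mul_rep hΛ.isRep i j
  have e1 : actL ρ (p i * p j) = ∑ y : I × I, ρ (p y.1 * p y.2) • ι (Λ i y.1 * Λ j y.2) +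
      ∑ b, ρ (p b) • (p i * ι (Λ j b)) + ∑ a, ρ (p a) • (ι (Λ i a) * p j) +
        ρ 1 • (p i * p j) := by
    rw [hB.actL_mul_p]
    simp only [hB.actL_p, LinearMap.comp_apply, LinearMap.mulRight_apply, add_mul, Finset.sum_mul,
      Finset.sum_add_distrib, smul_mul_assoc, one_mul, map_mul, Fintype.sum_prod_type_right,
      add_assoc]
  simp only [quadElem, map_sub, map_sum, map_smul, e1, hmr, hB.actL_p, Pi.add_apply,
    Finset.sum_apply, Pi.smul_apply, add_cmul, one_cmul, twist, sub_smul, smul_sub, smul_add,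
    Finset.sum_add_distrib, Finset.sum_sub_distrib]
  have e2 : ∑ a, ρ (p a) • ∑ s, η i (Λ j s) • ι (Λ s a) =
      ∑ s, η i (Λ j s) • ∑ a, ρ (p a) • ι (Λ s a) := by
    simp only [Finset.smul_sum]
    rw [Finset.sum_comm]
    exact Finset.sum_congr rfl fun s _ => Finset.sum_congr rfl fun a _ => smul_comm _ _ _
  have e3 : ∑ a, ρ (p a) • ∑ x : I × I, η x.1 (Λ x.2 a) • ι (Λ i x.1 * Λ j x.2) =
      ∑ x : I × I, (∑ s, η x.1 (Λ x.2 s) • ρ (p s)) • ι (Λ i x.1 * Λ j x.2) := by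
    simp only [Finset.smul_sum, Finset.sum_smul]
    rw [Finset.sum_comm]
    simp only [smul_smul, smul_eq_mul, mul_comm]
  have e4 : ∑ s, η i (Λ j s) • ρ 1 • p s = ∑ s, ρ 1 • η i (Λ j s) • p s :=
    Finset.sum_congr rfl fun s _ => smul_comm _ _ _
  rw [e2, e3, e4, Finset.smul_sum]
  simp only [cmul]
  abel

lemma IsInhomogeneous.actL_coeff (hB : IsInhomogeneous Λ ι p) (ρ : B →ₗ[ℂ] ℂ) (b : I → A) (c : A) :
    actL ρ (∑ i, ι (b i) * p i + ι c) =
      ∑ i, ι (actL (ρ ∘ₗ (ι : A →ₐ[ℂ] B).toLinearMap) (b i)) * p i +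
      ι (∑ i, ∑ u, actL ((ρ ∘ₗ LinearMap.mulRight ℂ (p u)) ∘ₗ (ι : A →ₐ[ℂ] B).toLinearMap) (b i)
        * Λ i u + actL (ρ ∘ₗ (ι : A →ₐ[ℂ] B).toLinearMap) c) := by
  simp only [map_add, map_sum, hB.actL_mul_p, actL_map, Finset.sum_add_distrib, map_mul]
  abel

/-- Existence of `T`. -/
lemma IsInhomogeneous.exists_quadRel (hB : IsInhomogeneous Λ ι p) (hΛ : HomogeneousData Λ)
    (hint : ∀ s r a, ∑ t, Λ s t * actL (f t r) a = ∑ t, actR (f s t) a * Λ t r)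
    (hmax : IsMaximal (ι : A →ₐ[ℂ] B) p Λ f)
    (hc : CrossRel (ι : A →ₐ[ℂ] B) p Λ f η) :
    ∃ T : I × I → ℂ, QuadRel (ι : A →ₐ[ℂ] B) p Λ f η T := by
  obtain ⟨P, P₀, hP, hPι, hP₀, hP₀ι⟩ := hB.exists_coord hΛ
  obtain ⟨χ, hχ1, hχ⟩ := exists_haar hΛ.completelyReducible
  set R := Rmat f Λ with hR
  have hR2 : (R - 1) * (R + 1) = 0 := by
    rw [sub_mul, mul_add, hmax.1, mul_one, one_mul, add_comm, sub_self]
  have hR2' : (R + 1) * (R - 1) = 0 := by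
    rw [add_mul, mul_sub, hmax.1, mul_one, one_mul]; abel
  let V : I × I → B := cmul (R - 1) (quadElem p Λ η)
  have hVΓ : ∀ k, ∃ (b : I → A) (c : A), V k = ∑ i, ι (b i) * p i + ι c := by
    intro k
    refine mem_Gam_iff (φ := (ι : A →ₐ[ℂ] B)).1 ?_
    have h1 := (hmax.2 fun x => (R - 1) k x).1 (by
      funext y
      exact congrArg (fun M : Matrix (I × I) (I × I) ℂ => M k y) hR2)
    have h2 : V k = ∑ i, ∑ j, (R - 1) k (i, j) • (p i * p j) -
        ∑ x : I × I, (R - 1) k x • ∑ s, η x.1 (Λ x.2 s) • p s := by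
      simp only [V, cmul, quadElem, smul_sub, Finset.sum_sub_distrib, Fintype.sum_prod_type]
    have hp : ∀ s, p s ∈ Gam (ι : A →ₐ[ℂ] B) p := fun s =>
      Submodule.mem_sup_left (Submodule.subset_span ⟨(1, s), by simp⟩)
    rw [h2]
    exact Submodule.sub_mem _ h1 (Submodule.sum_mem _ fun x _ => Submodule.smul_mem _ _
      (Submodule.sum_mem _ fun s _ => Submodule.smul_mem _ _ (hp s)))
  choose b c hbc using hVΓ
  have htw : ∀ T : I × I → ℂ, cmul (R - 1) (twist Λ T) = twist Λ ((R - 1).mulVec T) :=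
    cmul_sub_one_twist hΛ.isRep hint
  have hVρ : ∀ (ρ : B →ₗ[ℂ] ℂ) k, actL ρ (V k) =
      ι (twist Λ (fun y => ρ (V y)) k) + ρ 1 • V k := by
    intro ρ k
    have h1 : actL ρ (V k) = cmul (R - 1) (fun x => actL ρ (quadElem p Λ η x)) k := by
      simp [V, cmul]
    have h2 : cmul (R - 1) (∑ a, ρ (p a) • cmul (R + 1) (fun x : I × I => ι (Λ x.1 a) * p x.2))
        = 0 := by
      have : ∀ a, ρ (p a) • cmul (R + 1) (fun x : I × I => ι (Λ x.1 a) * p x.2) =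
          cmul (R + 1) (fun x : I × I => ρ (p a) • (ι (Λ x.1 a) * p x.2)) := by
        intro a
        funext x
        simp only [cmul, Pi.smul_apply, Finset.smul_sum, smul_comm (ρ (p a))]
      have h3 : ∀ (s : Finset I) (X : I → I × I → B), ∑ a ∈ s, cmul (R + 1) (X a) =
          cmul (R + 1) (∑ a ∈ s, X a) := by
        intro s X
        funext x
        simp only [cmul, Finset.sum_apply, Finset.smul_sum]
        exact Finset.sum_comm
      simp only [this]
      rw [h3, cmul_cmul, hR2, zero_cmul]
    rw [h1, hB.actL_quadElem hΛ hc, cmul_add, cmul_add, h2, add_zero, Pi.add_apply]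
    congr 1
    · have h3 : cmul (R - 1) (fun x => ι (twist Λ (fun y => ρ (quadElem p Λ η y)) x)) k =
          ι (cmul (R - 1) (twist Λ (fun y => ρ (quadElem p Λ η y))) k) := by
        simp [cmul]
      rw [h3, htw]
      congr 2
      funext y
      simp [V, cmul, Matrix.mulVec, dotProduct]
    · simp only [V, cmul, Finset.smul_sum]
      simp only [smul_comm (ρ 1)]
  have hcoef : ∀ (ρ : B →ₗ[ℂ] ℂ) k,
      (∀ i, actL (ρ ∘ₗ (ι : A →ₐ[ℂ] B).toLinearMap) (b k i) = ρ 1 • b k i) ∧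
      ∑ i, ∑ u, actL ((ρ ∘ₗ LinearMap.mulRight ℂ (p u)) ∘ₗ (ι : A →ₐ[ℂ] B).toLinearMap) (b k i)
        * Λ i u + actL (ρ ∘ₗ (ι : A →ₐ[ℂ] B).toLinearMap) (c k) =
      twist Λ (fun y => ρ (V y)) k + ρ 1 • c k := by
    intro ρ k
    have h1 := hVρ ρ k
    rw [hbc k, hB.actL_coeff] at h1
    have h2 := hB.coeff_ext hΛ (a' := fun i => ρ 1 • b k i)
      (b' := twist Λ (fun y => ρ (V y)) k + ρ 1 • c k) (h1.trans (by
        simp only [map_add, map_smul, smul_add, Finset.smul_sum, smul_mul_assoc]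
        abel))
    exact ⟨fun i => congrFun h2.1 i, h2.2⟩
  have hb : ∀ k i, b k i = Coalgebra.counit (R := ℂ) (b k i) • (1 : A) := by
    intro k i
    refine eq_of_forall_dual fun σ => ?_
    obtain ⟨ρ, hρ⟩ := exists_extend_dual hB.injective σ
    have hρ' : ρ ∘ₗ (ι : A →ₐ[ℂ] B).toLinearMap = σ := LinearMap.ext hρ
    have h1 := congrArg (Coalgebra.counit (R := ℂ)) ((hcoef ρ k).1 i)
    have h2 : ρ 1 = σ 1 := by rw [← hρ, map_one ι]
    rw [hρ', counit_actL, h2, map_smul] at h1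
    rw [h1, map_smul, smul_eq_mul, smul_eq_mul, mul_comm]
  have h0 : ∀ x : A, actL (0 : A →ₗ[ℂ] ℂ) x = 0 := fun x => by simp [actL]
  have hb0 : ∀ k i, b k i = 0 := by
    have hzero := hΛ.intertwiner_eq_zero hΛ.irreducible
      (fun i c e => Coalgebra.counit (R := ℂ) (b (i, c) e)) (fun i d r => by
        have h1 := (hcoef (Coalgebra.counit ∘ₗ P r) (i, d)).2
        have e0 : (Coalgebra.counit ∘ₗ P r) ∘ₗ (ι : A →ₐ[ℂ] B).toLinearMap = 0 := by
          ext a; simp [hPι]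
        have e1 : (Coalgebra.counit ∘ₗ P r) (1 : B) = 0 := by
          have := hPι r 1
          rw [map_one] at this
          simp [this]
        have e2 : ∀ u, ((Coalgebra.counit ∘ₗ P r) ∘ₗ LinearMap.mulRight ℂ (p u)) ∘ₗ
            (ι : A →ₐ[ℂ] B).toLinearMap = (1 : Matrix I I ℂ) u r • Coalgebra.counit := by
          intro u
          ext a
          simp [hP]
        have e3 : ∀ u (x : A), actL ((1 : Matrix I I ℂ) u r • (Coalgebra.counit : A →ₗ[ℂ] ℂ)) x =
            (1 : Matrix I I ℂ) u r • x := fun u x => by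
          rw [Matrix.one_apply]
          split_ifs <;> simp [h0]
        have e4 : ∀ y, (Coalgebra.counit ∘ₗ P r) (V y) = Coalgebra.counit (R := ℂ) (b y r) := by
          intro y
          simp [hbc y, hP, hPι, Matrix.one_apply]
        simp only [e0, e1, e2, e3, e4, h0, zero_smul, add_zero] at h1
        have e5 : ∑ j, ∑ u, ((1 : Matrix I I ℂ) u r • b (i, d) j) * Λ j u =
            ∑ j, Coalgebra.counit (R := ℂ) (b (i, d) j) • Λ j r := by
          refine Finset.sum_congr rfl fun j _ => ?_
          rw [Finset.sum_eq_single r (fun u _ hu => by simp [hu]) (by simp)]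
          conv_lhs => rw [hb]
          simp
        rw [← e5, h1, twist, Fintype.sum_prod_type])
    intro k i
    rw [hb, hzero k.1 k.2 i, zero_smul]
  have hVc : ∀ k, V k = ι (c k) := fun k => by rw [hbc]; simp [hb0]
  have hcχ : ∀ k, c k = χ (c k) • (1 : A) - twist Λ (fun y => χ (c y)) k := by
    intro k
    have h1 := (hcoef (χ ∘ₗ P₀) k).2
    have e0 : (χ ∘ₗ P₀) ∘ₗ (ι : A →ₐ[ℂ] B).toLinearMap = χ := by
      ext a; simp [hP₀ι]
    have e1 : (χ ∘ₗ P₀) (1 : B) = 1 := by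
      have := hP₀ι 1
      rw [map_one] at this
      simp [this, hχ1]
    have e2 : ∀ y, (χ ∘ₗ P₀) (V y) = χ (c y) := fun y => by
      simp [hVc, hP₀ι]
    simp only [e0, e1, e2, hb0, map_zero, zero_mul, Finset.sum_const_zero, zero_add, hχ,
      one_smul] at h1
    rw [h1]
    abel
  let t : I × I → ℂ := fun k => χ (c k)
  have ht : (R + 1).mulVec t = 0 := by
    have h1 : cmul (R + 1) V = 0 := by
      simp only [V]
      rw [cmul_cmul, hR2', zero_cmul]
    have h2 : cmul (R + 1) c = 0 := by
      funext k
      refine hB.injective ?_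
      have := congrFun h1 k
      simpa [cmul, hVc] using this
    funext k
    have := congrArg χ (congrFun h2 k)
    simpa [cmul, Matrix.mulVec, dotProduct, t] using this
  have ht' : (R - 1).mulVec ((2⁻¹ : ℂ) • t) = -t := by
    have h1 : (R - 1).mulVec t = -(2 : ℂ) • t := by
      have : R - 1 = (R + 1) - (2 : ℂ) • (1 : Matrix (I × I) (I × I) ℂ) := by
        rw [two_smul]; abel
      rw [this, Matrix.sub_mulVec, ht, Matrix.smul_mulVec, Matrix.one_mulVec, zero_sub, neg_smul]
    rw [Matrix.mulVec_smul, h1, smul_smul]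
    norm_num
  refine ⟨(2⁻¹ : ℂ) • t, quadRel_iff.2 ?_⟩
  funext k
  have e1 : cmul (R - 1) (fun x => algebraMap ℂ B (((2⁻¹ : ℂ) • t) x)) k =
      algebraMap ℂ B ((R - 1).mulVec ((2⁻¹ : ℂ) • t) k) := by
    simp only [cmul, Matrix.mulVec, dotProduct, map_sum, map_mul, ← Algebra.smul_def]
  have e2 : cmul (R - 1) (fun x => (ι : A →ₐ[ℂ] B) (twist Λ ((2⁻¹ : ℂ) • t) x)) k =
      ι (cmul (R - 1) (twist Λ ((2⁻¹ : ℂ) • t)) k) := by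
    simp [cmul]
  rw [Pi.sub_apply, Pi.add_apply, e1, e2, htw, ht']
  change V k + _ - _ = 0
  have e3 : twist Λ (-t) k = -twist Λ t k := by simp [twist]
  rw [hVc, hcχ, e3, map_neg, Pi.neg_apply, map_neg, map_sub, map_smul, map_one,
    Algebra.algebraMap_eq_smul_one]
  simp only [t]
  abel

end Quadratic

section Filtration

variable {A B C I : Type*} [Ring A] [Ring B] [Ring C] [Algebra ℂ C]

section General

variable [Bialgebra ℂ A] (φ : A →ₐ[ℂ] C) (q : I → C)

/-- The filtration by degree in the `q_i`; `fil φ q (n + 1)` consists of the elements of degree at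
most `n`. -/
def fil : ℕ → Submodule ℂ C
  | 0 => ⊥
  | n + 1 => LinearMap.range φ.toLinearMap ⊔ fil n * Submodule.span ℂ (Set.range q)

variable {φ q}

lemma map_mem_fil (n : ℕ) (a : A) : φ a ∈ fil φ q (n + 1) :=
  Submodule.mem_sup_left ⟨a, rfl⟩

lemma mul_mem_fil {n : ℕ} {x : C} (hx : x ∈ fil φ q n) (i : I) : x * q i ∈ fil φ q (n + 1) :=
  Submodule.mem_sup_right (Submodule.mul_mem_mul hx (Submodule.subset_span ⟨i, rfl⟩))

lemma mul_mem_fil_of_pred {n : ℕ} {x : C} (hx : x ∈ fil φ q (n - 1)) (i : I) :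
    x * q i ∈ fil φ q n := by
  cases n with
  | zero =>
    have : x = 0 := hx
    simp [this]
  | succ n => exact mul_mem_fil hx i

lemma exists_of_mem_fil_succ [Fintype I] {n : ℕ} {x : C} (hx : x ∈ fil φ q (n + 1)) :
    ∃ (a : A) (y : I → C), (∀ i, y i ∈ fil φ q n) ∧ x = φ a + ∑ i, y i * q i := by
  classical
  obtain ⟨_, ⟨a, rfl⟩, z, hz, rfl⟩ := Submodule.mem_sup.1 hx
  suffices ∃ y : I → C, (∀ i, y i ∈ fil φ q n) ∧ z = ∑ i, y i * q i by
    obtain ⟨y, hy, rfl⟩ := this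
    exact ⟨a, y, hy, rfl⟩
  clear hx
  induction hz using Submodule.mul_induction_on' with
  | mem_mul_mem u hu v hv =>
    induction hv using Submodule.span_induction with
    | mem v h =>
      obtain ⟨i, rfl⟩ := h
      refine ⟨Pi.single i u, fun j => ?_, ?_⟩
      · rcases eq_or_ne j i with rfl | hj
        · simpa using hu
        · simp [hj]
      · rw [Finset.sum_eq_single i (fun b _ hb => by simp [hb]) (by simp)]
        simp
    | zero => exact ⟨0, fun i => Submodule.zero_mem _, by simp⟩
    | add v v' _ _ h h' =>
      obtain ⟨y, hy, h⟩ := h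
      obtain ⟨y', hy', h'⟩ := h'
      exact ⟨y + y', fun i => Submodule.add_mem _ (hy i) (hy' i), by
        simp [mul_add, h, h', add_mul, Finset.sum_add_distrib]⟩
    | smul c v _ h =>
      obtain ⟨y, hy, h⟩ := h
      exact ⟨c • y, fun i => Submodule.smul_mem _ _ (hy i), by simp [h, Finset.smul_sum]⟩
  | add u _ v _ h h' =>
    obtain ⟨y, hy, rfl⟩ := h
    obtain ⟨y', hy', rfl⟩ := h'
    exact ⟨y + y', fun i => Submodule.add_mem _ (hy i) (hy' i), by
      simp [add_mul, Finset.sum_add_distrib]⟩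

lemma fil_le_succ [Fintype I] (n : ℕ) : fil φ q n ≤ fil φ q (n + 1) := by
  induction n with
  | zero => exact bot_le
  | succ n ih =>
    intro x hx
    obtain ⟨a, y, hy, rfl⟩ := exists_of_mem_fil_succ hx
    exact Submodule.add_mem _ (map_mem_fil _ a)
      (Submodule.sum_mem _ fun i _ => mul_mem_fil (ih (hy i)) i)

lemma fil_mono [Fintype I] : Monotone (fil φ q) := monotone_nat_of_le_succ fil_le_succ

lemma map_fil [Fintype I] {D : Type*} [Ring D] [Algebra ℂ D] {φ' : A →ₐ[ℂ] D} {q' : I → D}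
    (π : C →ₐ[ℂ] D) (hφ : ∀ a, π (φ a) = φ' a) (hq : ∀ i, π (q i) = q' i) {n : ℕ} {x : C}
    (hx : x ∈ fil φ q n) : π x ∈ fil φ' q' n := by
  induction n generalizing x with
  | zero =>
    have : x = 0 := hx
    simp [this]
  | succ n ih =>
    obtain ⟨a, y, hy, rfl⟩ := exists_of_mem_fil_succ hx
    rw [map_add, hφ, map_sum]
    refine Submodule.add_mem _ (map_mem_fil _ a) (Submodule.sum_mem _ fun i _ => ?_)
    rw [map_mul, hq]
    exact mul_mem_fil (ih (hy i)) i

variable [Fintype I] {Λ : Matrix I I A} {f : I → I → A →ₗ[ℂ] ℂ} {η : I → A →ₗ[ℂ] ℂ}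
  {T : I × I → ℂ}

lemma CrossRel.mul_map_mem_fil (h : CrossRel φ q Λ f η) {n : ℕ} {x : C} (hx : x ∈ fil φ q n)
    (a : A) : x * φ a ∈ fil φ q n := by
  induction n generalizing x a with
  | zero =>
    have : x = 0 := hx
    simp [this]
  | succ n ih =>
    obtain ⟨b, y, hy, rfl⟩ := exists_of_mem_fil_succ hx
    rw [add_mul, ← map_mul, Finset.sum_mul]
    refine Submodule.add_mem _ (map_mem_fil _ _) (Submodule.sum_mem _ fun i _ => ?_)
    rw [mul_assoc, h, mul_sub, mul_add, Finset.mul_sum, Finset.mul_sum]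
    refine Submodule.sub_mem _ (Submodule.add_mem _ (Submodule.sum_mem _ fun t _ => ?_) ?_)
      (Submodule.sum_mem _ fun t _ => ?_)
    · rw [← mul_assoc]
      exact mul_mem_fil (ih (hy i) _) t
    · exact fil_le_succ _ (ih (hy i) _)
    · exact fil_le_succ _ (ih (hy i) _)

lemma CrossRel.exists_mem_fil (h : CrossRel φ q Λ f η) {x : C}
    (hx : x ∈ Algebra.adjoin ℂ (Set.range φ ∪ Set.range q)) : ∃ n, x ∈ fil φ q n := by
  suffices ∀ n, ∀ y ∈ fil φ q n, ∃ m, y * x ∈ fil φ q m by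
    obtain ⟨m, hm⟩ := this 1 1 (by simpa using map_mem_fil (φ := φ) (q := q) 0 1)
    exact ⟨m, by simpa using hm⟩
  induction hx using Algebra.adjoin_induction with
  | mem x hx =>
    rcases hx with ⟨a, rfl⟩ | ⟨i, rfl⟩
    · exact fun n y hy => ⟨n, h.mul_map_mem_fil hy a⟩
    · exact fun n y hy => ⟨n + 1, mul_mem_fil hy i⟩
  | algebraMap r =>
    intro n y hy
    refine ⟨n, ?_⟩
    rw [← Algebra.commutes, ← Algebra.smul_def]
    exact Submodule.smul_mem _ _ hy
  | add u v _ _ hu hv =>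
    intro n y hy
    obtain ⟨m, hm⟩ := hu n y hy
    obtain ⟨m', hm'⟩ := hv n y hy
    refine ⟨max m m', ?_⟩
    rw [mul_add]
    exact Submodule.add_mem _ (fil_mono (le_max_left _ _) hm) (fil_mono (le_max_right _ _) hm')
  | mul u v _ _ hu hv =>
    intro n y hy
    obtain ⟨m, hm⟩ := hu n y hy
    obtain ⟨m', hm'⟩ := hv m _ hm
    exact ⟨m', by rwa [← mul_assoc]⟩

variable [DecidableEq I]

/-- `R (q ⊗ q) = q ⊗ q` up to terms of lower degree. -/
lemma QuadRel.mul_mem_fil (hq : QuadRel φ q Λ f η T) (hc : CrossRel φ q Λ f η) {n : ℕ} {y : C}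
    (hy : y ∈ fil φ q n) (k : I × I) :
    ∑ x : I × I, Rmat f Λ k x • (y * q x.1 * q x.2) - y * q k.1 * q k.2 ∈ fil φ q (n + 1) := by
  have h1 := congrFun (quadRel_iff.1 hq) k
  have h2 : cmul (Rmat f Λ - 1) (quadElem q Λ η) k =
      (∑ x : I × I, Rmat f Λ k x • (q x.1 * q x.2) - q k.1 * q k.2) -
      ∑ x : I × I, (Rmat f Λ - 1) k x • ∑ s, η x.1 (Λ x.2 s) • q s := by
    have : quadElem q Λ η = (fun x => q x.1 * q x.2) -
      fun x : I × I => ∑ s, η x.1 (Λ x.2 s) • q s := rfl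
    rw [this, cmul_sub, sub_cmul, one_cmul]
    rfl
  rw [Pi.sub_apply, Pi.add_apply, h2] at h1
  have h3 : ∑ x : I × I, Rmat f Λ k x • (y * q x.1 * q x.2) - y * q k.1 * q k.2 =
      y * (∑ x : I × I, Rmat f Λ k x • (q x.1 * q x.2) - q k.1 * q k.2) := by
    simp only [mul_sub, Finset.mul_sum, mul_smul_comm, mul_assoc]
  rw [h3]
  have h4 : ∑ x : I × I, Rmat f Λ k x • (q x.1 * q x.2) - q k.1 * q k.2 =
      ∑ x : I × I, (Rmat f Λ - 1) k x • ∑ s, η x.1 (Λ x.2 s) • q s -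
      cmul (Rmat f Λ - 1) (fun x => algebraMap ℂ C (T x)) k +
      cmul (Rmat f Λ - 1) (fun x => φ (twist Λ T x)) k := by
    rw [← sub_eq_zero, ← h1, Pi.zero_apply] at *
    rw [← h1]
    abel
  rw [h4]
  simp only [cmul, mul_add, mul_sub, Finset.mul_sum, mul_smul_comm]
  refine Submodule.add_mem _ (Submodule.sub_mem _ (Submodule.sum_mem _ fun x _ =>
    Submodule.smul_mem _ _ (Submodule.sum_mem _ fun s _ => Submodule.smul_mem _ _ ?_))
    (Submodule.sum_mem _ fun x _ => Submodule.smul_mem _ _ ?_))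
    (Submodule.sum_mem _ fun x _ => Submodule.smul_mem _ _ ?_)
  · exact InhomQG.mul_mem_fil hy s
  · rw [← Algebra.commutes, ← Algebra.smul_def]
    exact Submodule.smul_mem _ _ (fil_le_succ _ hy)
  · exact fil_le_succ _ (hc.mul_map_mem_fil hy _)

/-- `Λ_dj q_i = R_{di,ct} q_c Λ_tj` up to terms of lower degree. -/
lemma CrossRel.swap_mem_fil (hc : CrossRel φ q Λ f η) (hΛ : IsRep Λ)
    (hR : Rmat f Λ * Rmat f Λ = 1) {n : ℕ} {y : C} (hy : y ∈ fil φ q n) (d i j : I) :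
    y * φ (Λ d j) * q i - ∑ x : I × I, Rmat f Λ (d, i) x • (y * q x.1 * φ (Λ x.2 j)) ∈
      fil φ q n := by
  let U : I × I → C := fun x => φ (Λ x.1 j) * q x.2
  let L : I × I → C := fun x => ∑ s, η x.1 (Λ x.2 s) • φ (Λ s j) -
        ∑ z : I × I, η z.1 (Λ z.2 j) • φ (Λ x.1 z.1 * Λ x.2 z.2)
  have h1 : (fun x : I × I => q x.1 * φ (Λ x.2 j)) = cmul (Rmat f Λ) U + L := by
    funext x
    rw [hc.mul_rep hΛ, add_sub_assoc]
    rfl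
  have h2 : ∑ x : I × I, Rmat f Λ (d, i) x • (q x.1 * φ (Λ x.2 j)) =
      φ (Λ d j) * q i + ∑ x, Rmat f Λ (d, i) x • L x := by
    have := congrFun (congrArg (cmul (Rmat f Λ)) h1) (d, i)
    rw [cmul_add, cmul_cmul, hR, one_cmul] at this
    exact this
  have h3 : y * φ (Λ d j) * q i - ∑ x : I × I, Rmat f Λ (d, i) x • (y * q x.1 * φ (Λ x.2 j)) =
      -∑ x, Rmat f Λ (d, i) x • (y * L x) := by
    have h4 := congrArg (y * ·) h2
    simp only [mul_add, Finset.mul_sum, mul_smul_comm, ← mul_assoc] at h4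
    rw [h4]
    abel
  rw [h3]
  refine Submodule.neg_mem _ (Submodule.sum_mem _ fun x _ => Submodule.smul_mem _ _ ?_)
  have h5 : L x = φ (∑ s, η x.1 (Λ x.2 s) • Λ s j -
      ∑ z : I × I, η z.1 (Λ z.2 j) • (Λ x.1 z.1 * Λ x.2 z.2)) := by
    simp [L]
  rw [h5]
  exact hc.mul_map_mem_fil hy _

end General

variable [Fintype I] [DecidableEq I] [HopfAlgebra ℂ A] [Bialgebra ℂ B] {Λ : Matrix I I A}
  {ι : A →ₐc[ℂ] B} {p : I → B} {f : I → I → A →ₗ[ℂ] ℂ} {η : I → A →ₗ[ℂ] ℂ} {T : I × I → ℂ}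

lemma IsInhomogeneous.actL_mem_fil (hB : IsInhomogeneous Λ ι p)
    (hc : CrossRel (ι : A →ₐ[ℂ] B) p Λ f η) {n : ℕ} (ρ : B →ₗ[ℂ] ℂ) {x : B}
    (hx : x ∈ fil (ι : A →ₐ[ℂ] B) p n) : actL ρ x ∈ fil (ι : A →ₐ[ℂ] B) p n := by
  induction n generalizing x ρ with
  | zero =>
    have : x = 0 := hx
    simp [this]
  | succ n ih =>
    obtain ⟨a, y, hy, rfl⟩ := exists_of_mem_fil_succ hx
    rw [map_add, map_sum]
    refine Submodule.add_mem _ ?_ (Submodule.sum_mem _ fun i _ => ?_)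
    · have : actL ρ (ι a) ∈ fil (ι : A →ₐ[ℂ] B) p (n + 1) := by
        rw [actL_map]
        exact map_mem_fil (φ := (ι : A →ₐ[ℂ] B)) n _
      exact this
    · rw [hB.actL_mul_p]
      exact Submodule.add_mem _ (Submodule.sum_mem _ fun u _ =>
        fil_le_succ _ (hc.mul_map_mem_fil (ih _ (hy i)) _)) (mul_mem_fil (ih _ (hy i)) i)

/-- If `γ` is the multiple `z ε` of the counit on `A`, then `γ * x = z x` up to lower degree. -/
lemma IsInhomogeneous.actL_sub_mem_fil (hB : IsInhomogeneous Λ ι p)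
    (hc : CrossRel (ι : A →ₐ[ℂ] B) p Λ f η) {n : ℕ} {γ : B →ₗ[ℂ] ℂ} {z : ℂ}
    (hγ : γ ∘ₗ (ι : A →ₐ[ℂ] B).toLinearMap = z • Coalgebra.counit) {x : B}
    (hx : x ∈ fil (ι : A →ₐ[ℂ] B) p (n + 1)) :
    actL γ x - z • x ∈ fil (ι : A →ₐ[ℂ] B) p n := by
  induction n generalizing x with
  | zero =>
    obtain ⟨a, y, hy, rfl⟩ := exists_of_mem_fil_succ hx
    have hy0 : ∀ i, y i = 0 := hy
    have h1 : actL γ (ι a) = z • ι a := by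
      rw [actL_map, hγ]
      have : actL (z • (Coalgebra.counit : A →ₗ[ℂ] ℂ)) a = z • a := by
        refine eq_of_forall_dual fun σ => ?_
        rw [dual_actL, map_smul, LinearMap.smul_apply, counit_actR]
      rw [this, map_smul]
    have h2 : actL γ ((ι : A →ₐ[ℂ] B) a) - z • (ι : A →ₐ[ℂ] B) a = 0 := sub_eq_zero.2 h1
    simp only [hy0, zero_mul, Finset.sum_const_zero, add_zero, h2]
    exact Submodule.zero_mem _
  | succ n ih =>
    obtain ⟨a, y, hy, rfl⟩ := exists_of_mem_fil_succ hx
    have h1 : actL γ ((ι : A →ₐ[ℂ] B) a + ∑ i, y i * p i) -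
        z • ((ι : A →ₐ[ℂ] B) a + ∑ i, y i * p i) =
        (actL γ ((ι : A →ₐ[ℂ] B) a) - z • (ι : A →ₐ[ℂ] B) a) +
          ∑ i, (∑ u, actL (γ ∘ₗ LinearMap.mulRight ℂ (p u)) (y i) * ι (Λ i u) +
            (actL γ (y i) - z • y i) * p i) := by
      simp only [map_add, map_sum, hB.actL_mul_p, smul_add, Finset.smul_sum, sub_mul,
        Finset.sum_add_distrib, Finset.sum_sub_distrib, smul_mul_assoc]
      abel
    rw [h1]
    refine Submodule.add_mem _ (fil_le_succ _ (ih (map_mem_fil n a)))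
      (Submodule.sum_mem _ fun i _ => Submodule.add_mem _ (Submodule.sum_mem _ fun u _ => ?_) ?_)
    · exact hc.mul_map_mem_fil (hB.actL_mem_fil hc _ (hy i)) _
    · exact mul_mem_fil (ih (hy i)) i

/-- Functionals on `B` picking out the coefficient of `p_j` at the counit. -/
lemma IsInhomogeneous.exists_partial (hB : IsInhomogeneous Λ ι p) (hΛ : HomogeneousData Λ) (j : I) :
    ∃ γ : B →ₗ[ℂ] ℂ, γ ∘ₗ (ι : A →ₐ[ℂ] B).toLinearMap = 0 ∧
      ∀ u, (γ ∘ₗ LinearMap.mulRight ℂ (p u)) ∘ₗ (ι : A →ₐ[ℂ] B).toLinearMap =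
        (1 : Matrix I I ℂ) u j • Coalgebra.counit := by
  obtain ⟨P, -, hP, hPι, -, -⟩ := hB.exists_coord hΛ
  refine ⟨Coalgebra.counit ∘ₗ P j, ?_, fun u => ?_⟩
  · ext a; simp [hPι]
  · ext a; simp [hP]

lemma IsInhomogeneous.partial_mul_mem_fil (hB : IsInhomogeneous Λ ι p)
    (hc : CrossRel (ι : A →ₐ[ℂ] B) p Λ f η) {j : I} {γ : B →ₗ[ℂ] ℂ}
    (hγ : ∀ u, (γ ∘ₗ LinearMap.mulRight ℂ (p u)) ∘ₗ (ι : A →ₐ[ℂ] B).toLinearMap =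
        (1 : Matrix I I ℂ) u j • Coalgebra.counit) {n : ℕ} {x : B}
    (hx : x ∈ fil (ι : A →ₐ[ℂ] B) p (n + 1)) (i : I) :
    actL γ (x * p i) - (actL γ x * p i + x * ι (Λ i j)) ∈ fil (ι : A →ₐ[ℂ] B) p n := by
  have h1 : actL γ (x * p i) - (actL γ x * p i + x * ι (Λ i j)) =
      ∑ u, (actL (γ ∘ₗ LinearMap.mulRight ℂ (p u)) x - (1 : Matrix I I ℂ) u j • x) *
        ι (Λ i u) := by
    rw [hB.actL_mul_p]
    simp only [sub_mul, Finset.sum_sub_distrib, smul_mul_assoc]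
    have : ∑ u, (1 : Matrix I I ℂ) u j • (x * ι (Λ i u)) = x * ι (Λ i j) := by
      simp [Matrix.one_apply]
    rw [this]
    abel
  rw [h1]
  exact Submodule.sum_mem _ fun u _ =>
    hc.mul_map_mem_fil (hB.actL_sub_mem_fil hc (hγ u) hx) _

variable {φ : A →ₐ[ℂ] C} {q : I → C}

/-- An analogue of Euler's identity for homogeneous polynomials: up to lower degree, `n d` is
recovered from the partial derivatives of `d`. -/
lemma IsInhomogeneous.exists_euler (hB : IsInhomogeneous Λ ι p) (hΛ : HomogeneousData Λ)
    (hR : Rmat f Λ * Rmat f Λ = 1) (hcB : CrossRel (ι : A →ₐ[ℂ] B) p Λ f η)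
    (hc : CrossRel φ q Λ f η) (hq : QuadRel φ q Λ f η T) (π : C →ₐ[ℂ] B)
    (hπφ : ∀ a, π (φ a) = ι a) (hπq : ∀ i, π (q i) = p i) {γ : I → B →ₗ[ℂ] ℂ}
    (hγι : ∀ j, γ j ∘ₗ (ι : A →ₐ[ℂ] B).toLinearMap = 0)
    (hγ : ∀ j u, (γ j ∘ₗ LinearMap.mulRight ℂ (p u)) ∘ₗ (ι : A →ₐ[ℂ] B).toLinearMap =
        (1 : Matrix I I ℂ) u j • Coalgebra.counit) (n : ℕ) {d : C} (hd : d ∈ fil φ q (n + 1)) :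
    ∃ y : I → C, (∀ t, y t ∈ fil φ q n) ∧ ∑ t, y t * q t - (n : ℂ) • d ∈ fil φ q n ∧
      ∀ j, actL (γ j) (π d) - ∑ t, π (y t) * ι (Λ t j) ∈ fil (ι : A →ₐ[ℂ] B) p (n - 1) := by
  have h0 : ∀ x : A, actL (0 : A →ₗ[ℂ] ℂ) x = 0 := fun x => by simp [actL]
  have hγa : ∀ j a, actL (γ j) (π (φ a)) = 0 := fun j a => by
    rw [hπφ, actL_map, hγι, h0, map_zero]
  induction n generalizing d with
  | zero =>
    obtain ⟨a, y, hy, rfl⟩ := exists_of_mem_fil_succ hd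
    have hy0 : ∀ i, y i = 0 := hy
    refine ⟨0, fun t => Submodule.zero_mem _, by simp, fun j => ?_⟩
    simp only [hy0, zero_mul, Finset.sum_const_zero, add_zero, hγa, Pi.zero_apply, map_zero,
      sub_zero]
    exact Submodule.zero_mem _
  | succ n ih =>
    obtain ⟨a, e, he, rfl⟩ := exists_of_mem_fil_succ hd
    choose y hy hyq hyγ using fun i => ih (he i)
    let Y : I → C := fun t =>
      ∑ i, (∑ k, ∑ c, Rmat f Λ (k, i) (c, t) • (y i k * q c) + (1 : Matrix I I ℂ) i t • e i)
    refine ⟨Y, fun t => ?_, ?_, fun j => ?_⟩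
    · exact Submodule.sum_mem _ fun i _ => Submodule.add_mem _ (Submodule.sum_mem _ fun k _ =>
        Submodule.sum_mem _ fun c _ => Submodule.smul_mem _ _ (mul_mem_fil (hy i k) c))
        (Submodule.smul_mem _ _ (he i))
    · have h1 : ∑ t, Y t * q t - ((n + 1 : ℕ) : ℂ) • (φ a + ∑ i, e i * q i) =
          ∑ i, ∑ k, (∑ x : I × I, Rmat f Λ (k, i) x • (y i k * q x.1 * q x.2) -
            y i k * q k * q i) +
          ∑ i, (∑ k, y i k * q k - (n : ℂ) • e i) * q i - ((n + 1 : ℕ) : ℂ) • φ a := by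
        have h2 : ∑ t, Y t * q t = ∑ i, ∑ k, ∑ x : I × I,
            Rmat f Λ (k, i) x • (y i k * q x.1 * q x.2) + ∑ i, e i * q i := by
          simp only [Y, Finset.sum_mul, add_mul, smul_mul_assoc, Finset.sum_add_distrib]
          congr 1
          · rw [Finset.sum_comm]
            refine Finset.sum_congr rfl fun i _ => ?_
            rw [Finset.sum_comm]
            refine Finset.sum_congr rfl fun k _ => ?_
            rw [Fintype.sum_prod_type_right]
          · rw [Finset.sum_comm]
            simp [Matrix.one_apply]
        rw [h2]
        simp only [Finset.sum_sub_distrib, sub_mul, Finset.sum_mul, smul_mul_assoc, Nat.cast_add,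
          Nat.cast_one, add_smul, one_smul, smul_add, Finset.smul_sum, Finset.sum_add_distrib]
        abel
      rw [h1]
      refine Submodule.sub_mem _ (Submodule.add_mem _ (Submodule.sum_mem _ fun i _ =>
        Submodule.sum_mem _ fun k _ => hq.mul_mem_fil hc (hy i k) (k, i))
        (Submodule.sum_mem _ fun i _ => mul_mem_fil (hyq i) i))
        (Submodule.smul_mem _ _ (map_mem_fil n a))
    · have h1 : actL (γ j) (π (φ a + ∑ i, e i * q i)) - ∑ t, π (Y t) * ι (Λ t j) =
          ∑ i, (actL (γ j) (π (e i) * p i) -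
            (actL (γ j) (π (e i)) * p i + π (e i) * ι (Λ i j))) +
          ∑ i, (actL (γ j) (π (e i)) - ∑ k, π (y i k) * ι (Λ k j)) * p i +
          ∑ i, ∑ k, (π (y i k) * ι (Λ k j) * p i -
            ∑ x : I × I, Rmat f Λ (k, i) x • (π (y i k) * p x.1 * ι (Λ x.2 j))) := by
        have h2 : ∑ t, π (Y t) * ι (Λ t j) = ∑ i, ∑ k, ∑ x : I × I,
            Rmat f Λ (k, i) x • (π (y i k) * p x.1 * ι (Λ x.2 j)) +
              ∑ i, π (e i) * ι (Λ i j) := by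
          simp only [Y, map_sum, map_add, map_smul, map_mul, hπq, Finset.sum_mul, add_mul,
            smul_mul_assoc, Finset.sum_add_distrib]
          congr 1
          · rw [Finset.sum_comm]
            refine Finset.sum_congr rfl fun i _ => ?_
            rw [Finset.sum_comm]
            refine Finset.sum_congr rfl fun k _ => ?_
            rw [Fintype.sum_prod_type_right]
          · rw [Finset.sum_comm]
            simp [Matrix.one_apply]
        rw [h2]
        simp only [map_add, hγa, map_sum, map_mul, hπq, Finset.sum_sub_distrib, sub_mul,
          Finset.sum_mul, Finset.sum_add_distrib]
        abel
      rw [h1]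
      have hmap : ∀ {m : ℕ} {x : C}, x ∈ fil φ q m → π x ∈ fil (ι : A →ₐ[ℂ] B) p m :=
        fun hx => map_fil π hπφ hπq hx
      refine Submodule.add_mem _ (Submodule.add_mem _ (Submodule.sum_mem _ fun i _ => ?_)
        (Submodule.sum_mem _ fun i _ => ?_)) (Submodule.sum_mem _ fun i _ =>
          Submodule.sum_mem _ fun k _ => ?_)
      · exact hB.partial_mul_mem_fil hcB (hγ j) (hmap (he i)) i
      · exact mul_mem_fil_of_pred (hyγ i j) i
      · exact hcB.swap_mem_fil hΛ.isRep hR (hmap (hy i k)) k i j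

/-- A homomorphism onto `B` preserving the generators is strict for the filtrations. -/
lemma IsInhomogeneous.mem_fil_of_map_mem_fil (hB : IsInhomogeneous Λ ι p) (hΛ : HomogeneousData Λ)
    (hR : Rmat f Λ * Rmat f Λ = 1) (hcB : CrossRel (ι : A →ₐ[ℂ] B) p Λ f η)
    (hc : CrossRel φ q Λ f η) (hq : QuadRel φ q Λ f η T) (π : C →ₐ[ℂ] B)
    (hπφ : ∀ a, π (φ a) = ι a) (hπq : ∀ i, π (q i) = p i) (n : ℕ) {d : C}
    (hd : d ∈ fil φ q (n + 1)) (hπd : π d ∈ fil (ι : A →ₐ[ℂ] B) p n) : d ∈ fil φ q n := by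
  choose γ hγι hγ using hB.exists_partial hΛ
  induction n generalizing d with
  | zero =>
    obtain ⟨a, y, hy, rfl⟩ := exists_of_mem_fil_succ hd
    have hy0 : ∀ i, y i = 0 := hy
    have h1 : π (φ a + ∑ i, y i * q i) = 0 := hπd
    simp only [hy0, zero_mul, Finset.sum_const_zero, add_zero, hπφ] at h1 ⊢
    rw [hB.injective (h1.trans (map_zero ι).symm), map_zero]
    exact Submodule.zero_mem _
  | succ n ih =>
    obtain ⟨y, hy, hyq, hyγ⟩ := hB.exists_euler hΛ hR hcB hc hq π hπφ hπq hγι hγ (n + 1) hd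
    have h1 : ∀ j, ∑ t, π (y t) * ι (Λ t j) ∈ fil (ι : A →ₐ[ℂ] B) p n := by
      intro j
      have h2 := hB.actL_sub_mem_fil hcB (γ := γ j) (z := 0) (by rw [hγι, zero_smul]) hπd
      rw [zero_smul, sub_zero] at h2
      have h3 := Submodule.sub_mem _ h2 (hyγ j)
      rwa [sub_sub_cancel] at h3
    have h4 : ∀ s, π (y s) ∈ fil (ι : A →ₐ[ℂ] B) p n := by
      intro s
      have h5 : π (y s) =
          ∑ j, (∑ t, π (y t) * ι (Λ t j)) * ι (HopfAlgebra.antipode ℂ (Λ j s)) := by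
        simp only [Finset.sum_mul, mul_assoc, ← map_mul]
        rw [Finset.sum_comm]
        simp only [← Finset.mul_sum, ← map_sum, hΛ.isRep.mul_antipode, map_smul, map_one]
        simp [Matrix.one_apply]
      rw [h5]
      exact Submodule.sum_mem _ fun j _ => hcB.mul_map_mem_fil (h1 j) _
    have h6 : ∑ t, y t * q t ∈ fil φ q (n + 1) :=
      Submodule.sum_mem _ fun t _ => mul_mem_fil (ih (hy t) (h4 t)) t
    have h7 := Submodule.sub_mem _ h6 hyq
    rw [sub_sub_cancel] at h7
    exact (Submodule.smul_mem_iff _ (Nat.cast_ne_zero.2 n.succ_ne_zero)).1 h7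

lemma IsInhomogeneous.eq_zero_of_map_eq_zero (hB : IsInhomogeneous Λ ι p) (hΛ : HomogeneousData Λ)
    (hR : Rmat f Λ * Rmat f Λ = 1) (hcB : CrossRel (ι : A →ₐ[ℂ] B) p Λ f η)
    (hc : CrossRel φ q Λ f η) (hq : QuadRel φ q Λ f η T) (π : C →ₐ[ℂ] B)
    (hπφ : ∀ a, π (φ a) = ι a) (hπq : ∀ i, π (q i) = p i) {d : C}
    (hd : d ∈ Algebra.adjoin ℂ (Set.range φ ∪ Set.range q)) (hπd : π d = 0) : d = 0 := by
  obtain ⟨n, hn⟩ := hc.exists_mem_fil hd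
  induction n with
  | zero => exact hn
  | succ n ih =>
    refine ih (hB.mem_fil_of_map_mem_fil hΛ hR hcB hc hq π hπφ hπq n hn ?_)
    rw [hπd]
    exact Submodule.zero_mem _

end Filtration

section UniversalProperty

variable {A : Type u} {B : Type v} {I : Type x} [Ring A] [Ring B] [Fintype I] [DecidableEq I]
  [HopfAlgebra ℂ A] [Bialgebra ℂ B] {Λ : Matrix I I A}
  {ι : A →ₐc[ℂ] B} {p : I → B} {f : I → I → A →ₗ[ℂ] ℂ} {η : I → A →ₗ[ℂ] ℂ} {T : I × I → ℂ}

lemma IsInhomogeneous.existsUnique_lift (hB : IsInhomogeneous Λ ι p) (hΛ : HomogeneousData Λ)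
    (hR : Rmat f Λ * Rmat f Λ = 1) (hcB : CrossRel (ι : A →ₐ[ℂ] B) p Λ f η)
    (hqB : QuadRel (ι : A →ₐ[ℂ] B) p Λ f η T) {C : Type*} [Ring C] [Algebra ℂ C]
    {φ : A →ₐ[ℂ] C} {q : I → C} (hc : CrossRel φ q Λ f η) (hq : QuadRel φ q Λ f η T) :
    ∃! ψ : B →ₐ[ℂ] C, (∀ a, ψ ((ι : A →ₐ[ℂ] B) a) = φ a) ∧ ∀ i, ψ (p i) = q i := by
  let Φ : A →ₐ[ℂ] B × C := (ι : A →ₐ[ℂ] B).prod φ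
  let Q : I → B × C := fun i => (p i, q i)
  have hC : CrossRel Φ Q Λ f η := by
    intro s a
    refine Prod.ext ?_ ?_
    · simpa [Φ, Q, Prod.fst_sum] using hcB s a
    · simpa [Φ, Q, Prod.snd_sum] using hc s a
  have hQ : QuadRel Φ Q Λ f η T := by
    intro k l
    refine Prod.ext ?_ ?_
    · simpa [Φ, Q, Prod.fst_sum] using hqB k l
    · simpa [Φ, Q, Prod.snd_sum] using hq k l
  let S := Algebra.adjoin ℂ (Set.range Φ ∪ Set.range Q)
  let e : S →ₐ[ℂ] B := (AlgHom.fst ℂ B C).comp S.val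
  have hinj : Function.Injective e := by
    refine (injective_iff_map_eq_zero e).2 fun d hd => Subtype.ext ?_
    exact hB.eq_zero_of_map_eq_zero hΛ hR hcB hC hQ (AlgHom.fst ℂ B C) (fun a => rfl)
      (fun i => rfl) d.2 hd
  have hsurj : Function.Surjective e := by
    rw [← AlgHom.range_eq_top, eq_top_iff, ← hB.generates]
    refine Algebra.adjoin_le ?_
    rintro _ (⟨a, rfl⟩ | ⟨i, rfl⟩)
    · exact ⟨⟨Φ a, Algebra.subset_adjoin (Or.inl ⟨a, rfl⟩)⟩, rfl⟩
    · exact ⟨⟨Q i, Algebra.subset_adjoin (Or.inr ⟨i, rfl⟩)⟩, rfl⟩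
  let E := AlgEquiv.ofBijective e ⟨hinj, hsurj⟩
  let ψ : B →ₐ[ℂ] C := ((AlgHom.snd ℂ B C).comp S.val).comp E.symm.toAlgHom
  have hψ : ∀ d : S, ψ (d : B × C).1 = (d : B × C).2 := by
    intro d
    have : E.symm (d : B × C).1 = d := E.symm_apply_apply d
    change ((E.symm (d : B × C).1 : S) : B × C).2 = _
    rw [this]
  refine ⟨ψ, ⟨fun a => ?_, fun i => ?_⟩, fun ψ' h => ?_⟩
  · exact hψ ⟨Φ a, Algebra.subset_adjoin (Or.inl ⟨a, rfl⟩)⟩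
  · exact hψ ⟨Q i, Algebra.subset_adjoin (Or.inr ⟨i, rfl⟩)⟩
  · refine AlgHom.ext_of_adjoin_eq_top hB.generates ?_
    rintro _ (⟨a, rfl⟩ | ⟨i, rfl⟩)
    · exact (h.1 a).trans (hψ ⟨Φ a, Algebra.subset_adjoin (Or.inl ⟨a, rfl⟩)⟩).symm
    · exact (h.2 i).trans (hψ ⟨Q i, Algebra.subset_adjoin (Or.inr ⟨i, rfl⟩)⟩).symm

end UniversalProperty

section RMatrixForm

variable {A C I : Type*} [Ring A] [Ring C] [Algebra ℂ C]

lemma scal_mul_apply {l m n : Type*} [Fintype m] (M : Matrix l m ℂ) (X : Matrix m n C) (i : l)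
    (j : n) : (scal C M * X) i j = ∑ x, M i x • X x j := by
  simp only [scal, Matrix.mul_apply, Matrix.map_apply, ← Algebra.smul_def]

lemma mul_scal_apply {l m n : Type*} [Fintype m] (X : Matrix l m C) (M : Matrix m n ℂ) (i : l)
    (j : n) : (X * scal C M) i j = ∑ x, M x j • X i x := by
  simp only [scal, Matrix.mul_apply, Matrix.map_apply, ← Algebra.commutes, ← Algebra.smul_def]

lemma sum_sumUnit_prod {M : Type*} [AddCommMonoid M] [Fintype I]
    (F : (I ⊕ Unit) × (I ⊕ Unit) → M) :
    ∑ x, F x = ∑ x : I × I, F (Sum.inl x.1, Sum.inl x.2) + ∑ i, F (Sum.inl i, Sum.inr ()) +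
      (∑ i, F (Sum.inr (), Sum.inl i) + F (Sum.inr (), Sum.inr ())) := by
  simp only [Fintype.sum_prod_type, Fintype.sum_sum_type, Finset.sum_add_distrib,
    Finset.univ_unique, Finset.sum_singleton, PUnit.default_eq_unit]
  abel

variable [Fintype I]

section Bialg

variable [Bialgebra ℂ A] {Λ : Matrix I I A} {f : I → I → A →ₗ[ℂ] ℂ} {η : I → A →ₗ[ℂ] ℂ}
  {φ : A →ₐ[ℂ] C} {q : I → C} {T : I × I → ℂ}

/-- The upper right block of `(𝒫 ⊗ w) N_w = N_w (w ⊗ 𝒫)`. -/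
lemma nmat_upper_right_iff {n : Type*} [Fintype n] [DecidableEq n] {w : Matrix n n A}
    (hw : IsRep w) (s : I) (c d : n) :
    ((Pmat φ Λ q ⊗ₖ w.map φ) * scal C (Nmat f η w)) (Sum.inl s, c) (d, Sum.inr ()) =
        (scal C (Nmat f η w) * (w.map φ ⊗ₖ Pmat φ Λ q)) (Sum.inl s, c) (d, Sum.inr ()) ↔
      q s * φ (w c d) = ∑ t, φ (actR (f s t) (w c d)) * q t + φ (actR (η s) (w c d)) -
        ∑ t, φ (Λ s t * actL (η t) (w c d)) := by
  rw [eq_sub_iff_add_eq]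
  simp [mul_scal_apply, scal_mul_apply, Fintype.sum_prod_type, Nmat, Pmat, Gmat, Hmat,
    Matrix.one_apply, hw.actR, hw.actL, Finset.mul_sum, Finset.sum_mul, Finset.sum_add_distrib]
  rw [add_comm (q s * φ (w c d)), Finset.sum_comm (s := (Finset.univ : Finset n))]

lemma CrossRel.pnRel (h : CrossRel φ q Λ f η)
    (hint : ∀ s r a, ∑ t, Λ s t * actL (f t r) a = ∑ t, actR (f s t) a * Λ t r) :
    PNRel φ q Λ f η := by
  intro n w hw
  ext ⟨s, c⟩ ⟨d, r⟩
  rcases s with s | ⟨⟩ <;> rcases r with r | ⟨⟩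
  · have := congrArg φ (hint s r (w c d))
    simp [mul_scal_apply, scal_mul_apply, Fintype.sum_prod_type, Nmat, Pmat, Gmat, Hmat,
      Matrix.one_apply, hw.actR, hw.actL, Finset.mul_sum, Finset.sum_mul] at this ⊢
    rw [this, Finset.sum_comm]
  · exact (nmat_upper_right_iff hw s c d).2 (h s _)
  · simp [mul_scal_apply, scal_mul_apply, Fintype.sum_prod_type, Nmat, Pmat]
  · simp [mul_scal_apply, scal_mul_apply, Fintype.sum_prod_type, Nmat, Pmat, Matrix.one_apply]

variable [DecidableEq I]

lemma CrossRel.rpRel_iff (h : CrossRel φ q Λ f η) (hΛ : IsRep Λ)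
    (hR : Rmat f Λ * Rmat f Λ = 1)
    (hint : ∀ s r a, ∑ t, Λ s t * actL (f t r) a = ∑ t, actR (f s t) a * Λ t r) :
    RPRel φ q Λ f η T ↔ QuadRel φ q Λ f η T := by
  have key : ∀ k l,
      (scal C (RPmat (Rmat f Λ) (Zmat η Λ) T) * (Pmat φ Λ q ⊗ₖ Pmat φ Λ q))
          (Sum.inl k, Sum.inl l) (Sum.inr (), Sum.inr ()) -
        ((Pmat φ Λ q ⊗ₖ Pmat φ Λ q) * scal C (RPmat (Rmat f Λ) (Zmat η Λ) T))
          (Sum.inl k, Sum.inl l) (Sum.inr (), Sum.inr ()) =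
      cmul (Rmat f Λ - 1) (quadElem q Λ η) (k, l) +
        cmul (Rmat f Λ - 1) (fun x => algebraMap ℂ C (T x)) (k, l) -
        cmul (Rmat f Λ - 1) (fun x => φ (twist Λ T x)) (k, l) := by
    intro k l
    have h1 : quadElem q Λ η = (fun x => q x.1 * q x.2) - cmul (Zmat η Λ) q := rfl
    have h2 : cmul (Rmat f Λ - 1) (fun x => φ (twist Λ T x)) (k, l) =
        φ (cmul (Rmat f Λ - 1) (twist Λ T) (k, l)) := by
      simp [cmul]
    have h3 : cmul (Rmat f Λ - 1) (fun x => algebraMap ℂ C (T x)) (k, l) =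
        (Rmat f Λ - 1).mulVec T (k, l) • (1 : C) := by
      simp only [cmul, Matrix.mulVec, dotProduct, Finset.sum_smul, Algebra.algebraMap_eq_smul_one,
        smul_smul]
    rw [h1, h2, h3, cmul_sub_one_twist hΛ hint, cmul_sub, cmul_cmul, Matrix.sub_mul,
      Matrix.one_mul, sub_cmul, sub_cmul, one_cmul]
    simp [mul_scal_apply, scal_mul_apply, sum_sumUnit_prod, RPmat, Pmat, cmul, twist]
    abel
  rw [quadRel_iff]
  refine ⟨fun hRP => ?_, fun hQ => ?_⟩
  · funext ⟨k, l⟩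
    have h1 := key k l
    rw [hRP, sub_self] at h1
    exact h1.symm
  · ext ⟨k, l⟩ ⟨i, j⟩
    rcases k with k | ⟨⟩ <;> rcases l with l | ⟨⟩ <;> rcases i with i | ⟨⟩ <;>
      rcases j with j | ⟨⟩
    case inl.inl.inl.inl =>
      have := congrArg φ (rmat_intertwine hΛ hint (k, l) (i, j))
      simp [mul_scal_apply, scal_mul_apply, sum_sumUnit_prod, RPmat, Pmat] at this ⊢
      exact this
    case inl.inl.inl.inr =>
      have := h.mul_rep hΛ k l i
      simp [mul_scal_apply, scal_mul_apply, sum_sumUnit_prod, RPmat, Pmat, Matrix.one_apply]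
        at this ⊢
      rw [this]
      exact (add_sub_cancel _ _).symm
    case inl.inl.inr.inl =>
      have h1 : (fun x : I × I => q x.1 * φ (Λ x.2 j)) =
          cmul (Rmat f Λ) (fun x => φ (Λ x.1 j) * q x.2) + cmul (Zmat η Λ) (fun s => φ (Λ s j)) -
            fun x => φ (twist Λ (fun y => Zmat η Λ y j) x) := by
        funext x
        simp only [h.mul_rep hΛ, twist, map_sum, map_smul, Pi.sub_apply, Pi.add_apply, cmul]
        rfl
      have h2 : cmul (Rmat f Λ) (fun x => φ (twist Λ (fun y => Zmat η Λ y j) x)) =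
          fun x => φ (twist Λ (fun y => (Rmat f Λ * Zmat η Λ) y j) x) := by
        funext x
        rw [show (fun y => (Rmat f Λ * Zmat η Λ) y j) =
          (Rmat f Λ).mulVec (fun y => Zmat η Λ y j) from rfl, ← cmul_twist hΛ hint]
        simp [cmul]
      have h3 := congrFun (congrArg (cmul (Rmat f Λ)) h1) (k, l)
      rw [cmul_sub, cmul_add, cmul_cmul, cmul_cmul, hR, one_cmul, h2] at h3
      simp only [cmul, Pi.sub_apply, Pi.add_apply, twist, map_sum, map_smul, map_mul] at h3
      simp [mul_scal_apply, scal_mul_apply, sum_sumUnit_prod, RPmat, Pmat, Matrix.one_apply]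
      rw [h3]
      abel
    case inl.inl.inr.inr =>
      rw [← sub_eq_zero, key]
      exact congrFun hQ (k, l)
    all_goals
      simp [mul_scal_apply, scal_mul_apply, sum_sumUnit_prod, RPmat, Pmat, Matrix.one_apply]

end Bialg

variable [HopfAlgebra ℂ A] [DecidableEq I] {Λ : Matrix I I A} {f : I → I → A →ₗ[ℂ] ℂ}
  {η : I → A →ₗ[ℂ] ℂ} {φ : A →ₐ[ℂ] C} {q : I → C}

lemma PNRel.crossRel (h : PNRel φ q Λ f η) (hΛ : HomogeneousData Λ) : CrossRel φ q Λ f η := by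
  intro s
  refine fun a => LinearMap.congr_fun (linearMap_ext_irrep hΛ.completelyReducible
    (f := LinearMap.mulLeft ℂ (q s) ∘ₗ φ.toLinearMap)
    (g := ∑ t, LinearMap.mulRight ℂ (q t) ∘ₗ φ.toLinearMap ∘ₗ actR (f s t) +
      φ.toLinearMap ∘ₗ actR (η s) -
      ∑ t, φ.toLinearMap ∘ₗ LinearMap.mulLeft ℂ (Λ s t) ∘ₗ actL (η t))
    fun n w hw c d => ?_) a |>.trans (by simp)
  have := (nmat_upper_right_iff hw.1 s c d).1
    (congrArg (fun M => M (Sum.inl s, c) (d, Sum.inr ())) (h n w hw.1))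
  simpa using this

end RMatrixForm

end
end InhomQG

theorem corollary3p8 {A : Type u} {B : Type v} {I : Type x} [Ring A]
    [HopfAlgebra ℂ A] [Ring B] [Bialgebra ℂ B] [Fintype I] [DecidableEq I]
    (Λ : Matrix I I A) (hΛ : InhomQG.HomogeneousData Λ)
    (ι : A →ₐc[ℂ] B) (p : I → B) (hB : InhomQG.IsInhomogeneous Λ ι p) :
    (∃! f : I → I → A →ₗ[ℂ] ℂ, InhomQG.IsLeading (ι : A →ₐ[ℂ] B) p f) ∧
    ∀ f : I → I → A →ₗ[ℂ] ℂ, InhomQG.IsLeading (ι : A →ₐ[ℂ] B) p f →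
      InhomQG.IsMaximal (ι : A →ₐ[ℂ] B) p Λ f →
      (∃ (η : I → A →ₗ[ℂ] ℂ) (T : I × I → ℂ), InhomQG.IsStructureData Λ f η ∧
        InhomQG.CrossRel (ι : A →ₐ[ℂ] B) p Λ f η ∧
        InhomQG.QuadRel (ι : A →ₐ[ℂ] B) p Λ f η T) ∧
      ∀ (η : I → A →ₗ[ℂ] ℂ) (T : I × I → ℂ),
        InhomQG.CrossRel (ι : A →ₐ[ℂ] B) p Λ f η →
        InhomQG.QuadRel (ι : A →ₐ[ℂ] B) p Λ f η T →
        InhomQG.IsUniversalCrossQuad.{w} (ι : A →ₐ[ℂ] B) p Λ f η T ∧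
        InhomQG.IsUniversalRMatrix.{w} (ι : A →ₐ[ℂ] B) p Λ f η T := by
  obtain ⟨f₀, hf₀⟩ := hB.exists_isLeading hΛ
  refine ⟨⟨f₀, hf₀, fun f hf => hB.isLeading_unique hΛ hf hf₀⟩, fun f hf hmax => ?_⟩
  obtain ⟨h, hh⟩ := hB.exists_remainder hΛ hf
  have hint := hB.leading_intertwine hΛ hh
  refine ⟨?_, fun η T hc hq => ⟨⟨⟨hc, hq⟩, fun C _ _ φ q hcC hqC =>
    hB.existsUnique_lift hΛ hmax.1 hc hq hcC hqC⟩, ⟨hc.pnRel hint,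
    (hc.rpRel_iff hΛ.irreducible.1 hmax.1 hint).2 hq⟩, fun C _ _ φ q hN hRP => ?_⟩⟩
  · obtain ⟨η, hη⟩ := hB.exists_coboundary hΛ hh
    have hc : InhomQG.CrossRel (ι : A →ₐ[ℂ] B) p Λ f η := by
      intro s a
      have h1 := hh s a
      rw [hη, map_sub, map_sum, ← add_sub_assoc] at h1
      exact h1
    obtain ⟨T, hT⟩ := hB.exists_quadRel hΛ hint hmax hc
    exact ⟨η, T, hB.isStructureData hΛ hh hη, hc, hT⟩
  · have hcC := hN.crossRel hΛ
    exact hB.existsUnique_lift hΛ hmax.1 hc hq hcC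
      ((hcC.rpRel_iff hΛ.irreducible.1 hmax.1 hint).1 hRP)
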